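/- **Proposition (Lower bound on the rBDF ground state energy).** Let $\alpha>0$, $\Lambda>0$, and for a tempered distribution $f$ on $\mathbb R^3$ let $\hat f$ be its Fourier transform, normalized by $\hat f(k)=(2\pi)^{-3/2}\int_{\mathbb R^3}f(x)e^{-ik\cdot x}\,dx$. Let $\mathcal C$ be the Coulomb space of all tempered distributions $f$ on $\mathbb R^3$ for which $\hat f$ is a function with $\int_{\mathbb R^3}|\hat f(k)|^2|k|^{-2}\,dk<\infty$, with the inner product $$D(f,g)=4\pi\int_{\mathbb R^3}\frac{\hat f(k)\overline{\hat g(k)}}{|k|^2}\,dk .$$ Let $\mathfrak H_\Lambda=\{f\in L^2(\mathbb R^3,\mathbb C^4):\ \operatorname{supp}\hat f\subset \overline{B}(0,\Lambda)\}$, let $D^0=-i\boldsymbol\alpha\cdot\nabla+\beta$ be the free Dirac operator restricted to $\mathfrak H_\Lambda$ (with the usual Dirac matrices $\alpha_1,\alpha_2,\alpha_3,\beta$), let $P^0_-=\mathbf 1_{(-\infty,0)}(D^0)$ and $P^0_+=1-P^0_-$. For an operator $Q$ on $\mathfrak H_\Lambda$ write $Q_{\epsilon\epsilon'}=P^0_\epsilon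 QP^0_{\epsilon'}$, and $\operatorname{tr}_0(Q)=\operatorname{tr}(Q_{++}+Q_{--})$. Let $\mathcal K$ be the set of all self-adjoint Hilbert–Schmidt operators $Q$ on $\mathfrak H_\Lambda$ such that $Q_{++}$ and $Q_{--}$ are trace class and $-P^0_-\le Q\le 1-P^0_-$. Let $\rho_Q(x)=\operatorname{tr}_{\mathbb C^4}Q(x,x)$, where $Q(x,y)$ is the smooth $4\times4$ matrix kernel of $Q$. For $\nu\in\mathcal C$ and $Z>0$ put $$\mathcal E^{Z\nu}(Q)=\operatorname{tr}_0(D^0Q)-\alpha D(\rho_Q,Z\nu)+\frac{\alpha}{2}D(\rho_Q,\rho_Q),\qquad E(Z)=\inf\{\mathcal E^{Z\nu}(Q):\ Q\in\mathcal K\}.$$ If $\nu\in\mathcal C\cap L^1(\mathbb R^3,\mathbb R)$ and $\int_{\mathbb R^3}|\nu|=1$, then for all $Z>0$ $$E(Z)\ \ge\ -c_2\,\alpha\Lambda Z^{5/3},\qquad c_2=2^{-4/3}3^{2/3}\pi^{-1/3}.$$ -/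

import Mathlib

open MeasureTheory FourierTransform SchwartzMap
open scoped ENNReal InnerProductSpace

noncomputable section

namespace RBDF

/-! ### One-particle space -/

/-- Physical space `ℝ³`. -/
abbrev E3 : Type := EuclideanSpace ℝ (Fin 3)

/-- The spinor space `ℂ⁴`. -/
abbrev Spinor : Type := EuclideanSpace ℂ (Fin 4)

/-- `L²(ℝ³, ℂ⁴)`. -/
abbrev L2Spinor : Type := Lp Spinor 2 (volume : Measure E3)

/-- The ball `|k| ≤ Λ` in momentum space. Mathlib's Fourier transform uses the phase
`exp (-2πi⟨x, ξ⟩)`, so its frequency `ξ` corresponds to the momentum `k = 2πξ`. -/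
def momentumBall (Λ : ℝ) : Set E3 := {ξ | 2 * Real.pi * ‖ξ‖ ≤ Λ}

theorem isClosed_momentumBall (Λ : ℝ) : IsClosed (momentumBall Λ) :=
  isClosed_le (by fun_prop) continuous_const

theorem isBounded_momentumBall (Λ : ℝ) : Bornology.IsBounded (momentumBall Λ) := by
  refine (Metric.isBounded_closedBall (x := (0 : E3)) (r := Λ / (2 * Real.pi))).subset ?_
  intro ξ hξ
  rw [mem_closedBall_zero_iff, le_div_iff₀ (by positivity)]
  have h : 2 * Real.pi * ‖ξ‖ ≤ Λ := hξ
  linarith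

theorem isCompact_momentumBall (Λ : ℝ) : IsCompact (momentumBall Λ) :=
  Metric.isCompact_of_isClosed_isBounded (isClosed_momentumBall Λ) (isBounded_momentumBall Λ)

/-- The one-particle Hilbert space of all `f ∈ L²(ℝ³, ℂ⁴)` whose Fourier transform is supported in
the ball of radius `Λ` (see `mem_oneParticleSpace`). -/
def oneParticleSpace (Λ : ℝ) : Submodule ℂ L2Spinor :=
  LinearMap.ker
    ((LpToLpRestrictCLM E3 Spinor ℂ volume 2 (momentumBall Λ)ᶜ ∘L
      (Lp.fourierTransformₗᵢ E3 Spinor).toContinuousLinearEquiv.toContinuousLinearMap) :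
        L2Spinor →ₗ[ℂ] Lp Spinor 2 (volume.restrict (momentumBall Λ)ᶜ))

theorem mem_oneParticleSpace {Λ : ℝ} {f : L2Spinor} :
    f ∈ oneParticleSpace Λ ↔ ∀ᵐ ξ : E3, ξ ∉ momentumBall Λ → (𝓕 f : L2Spinor) ξ = 0 := by
  have hm : MeasurableSet (momentumBall Λ)ᶜ := (isClosed_momentumBall Λ).measurableSet.compl
  have h1 : f ∈ oneParticleSpace Λ ↔
      LpToLpRestrictCLM E3 Spinor ℂ volume 2 (momentumBall Λ)ᶜ (𝓕 f : L2Spinor) = 0 := Iff.rfl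
  rw [h1, Lp.eq_zero_iff_ae_eq_zero]
  have h2 := LpToLpRestrictCLM_coeFn (μ := (volume : Measure E3)) (p := 2) ℂ (momentumBall Λ)ᶜ
    (𝓕 f : L2Spinor)
  have h3 : (∀ᵐ ξ : E3, ξ ∉ momentumBall Λ → (𝓕 f : L2Spinor) ξ = 0) ↔
      ∀ᵐ ξ ∂(volume.restrict (momentumBall Λ)ᶜ), (𝓕 f : L2Spinor) ξ = 0 :=
    (ae_restrict_iff' hm).symm
  rw [h3]
  constructor
  · intro h
    filter_upwards [h, h2] with ξ a b
    rw [← b, a]; rfl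
  · intro h
    filter_upwards [h, h2] with ξ a b
    rw [b, a]; rfl

/-- The one-particle space as a type. -/
abbrev OneParticle (Λ : ℝ) : Type := oneParticleSpace Λ

instance (Λ : ℝ) : CompleteSpace (OneParticle Λ) := by
  have h : IsClosed (oneParticleSpace Λ : Set L2Spinor) :=
    ContinuousLinearMap.isClosed_ker
      (LpToLpRestrictCLM E3 Spinor ℂ volume 2 (momentumBall Λ)ᶜ ∘L
        (Lp.fourierTransformₗᵢ E3 Spinor).toContinuousLinearEquiv.toContinuousLinearMap)
  exact h.completeSpace_coe

/-! ### The Dirac operator and the free vacuum -/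

/-- The Pauli matrices. -/
def pauli : Fin 3 → Matrix (Fin 2) (Fin 2) ℂ :=
  ![!![0, 1; 1, 0], !![0, -Complex.I; Complex.I, 0], !![1, 0; 0, -1]]

/-- The Dirac matrices `α₁, α₂, α₃`. -/
def diracAlpha (i : Fin 3) : Matrix (Fin 4) (Fin 4) ℂ :=
  (Matrix.fromBlocks 0 (pauli i) (pauli i) 0).reindex
    (finSumFinEquiv (m := 2) (n := 2)) (finSumFinEquiv (m := 2) (n := 2))

/-- The Dirac matrix `β`. -/
def diracBeta : Matrix (Fin 4) (Fin 4) ℂ :=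
  (Matrix.fromBlocks 1 0 0 (-1)).reindex
    (finSumFinEquiv (m := 2) (n := 2)) (finSumFinEquiv (m := 2) (n := 2))

/-- The symbol `α · p + β` of `-i α · ∇ + β`. -/
def diracSymbol (p : E3) : Matrix (Fin 4) (Fin 4) ℂ :=
  ∑ i : Fin 3, (p i : ℂ) • diracAlpha i + diracBeta

/-- The symbol `α · (2πξ) + β`, as an operator on `ℂ⁴`, cut off outside the momentum ball. -/
def cutoffSymbol (Λ : ℝ) (ξ : E3) : Spinor →L[ℂ] Spinor :=
  (momentumBall Λ).indicator
    (fun ξ => Matrix.toEuclideanCLM (n := Fin 4) (𝕜 := ℂ) (diracSymbol ((2 * Real.pi) • ξ))) ξ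

theorem continuous_toEuclideanCLM_diracSymbol : Continuous fun ξ : E3 =>
    Matrix.toEuclideanCLM (n := Fin 4) (𝕜 := ℂ) (diracSymbol ((2 * Real.pi) • ξ)) := by
  have h1 : Continuous fun ξ : E3 => diracSymbol ((2 * Real.pi) • ξ) := by
    unfold diracSymbol
    fun_prop
  have h2 : Continuous (Matrix.toEuclideanCLM (n := Fin 4) (𝕜 := ℂ)) :=
    LinearMap.continuous_of_finiteDimensional
      (Matrix.toEuclideanCLM (n := Fin 4) (𝕜 := ℂ)).toAlgEquiv.toLinearMap
  exact h2.comp h1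

theorem memLp_cutoffSymbol (Λ : ℝ) : MemLp (cutoffSymbol Λ) ∞ (volume : Measure E3) := by
  obtain ⟨C, hC⟩ := (isCompact_momentumBall Λ).exists_bound_of_continuousOn
    continuous_toEuclideanCLM_diracSymbol.continuousOn
  refine memLp_top_of_bound (C := max C 0) ?_ (Filter.Eventually.of_forall fun ξ => ?_)
  · exact (continuous_toEuclideanCLM_diracSymbol.stronglyMeasurable.indicator
      (isClosed_momentumBall Λ).measurableSet).aestronglyMeasurable
  · by_cases h : ξ ∈ momentumBall Λ
    · simpa [cutoffSymbol, h] using Or.inl (hC ξ h)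
    · simp [cutoffSymbol, h]

/-- Multiplication by the cut-off symbol, in Fourier space. -/
def symbolMul (Λ : ℝ) : L2Spinor →L[ℂ] L2Spinor :=
  (ContinuousLinearMap.id ℂ (Spinor →L[ℂ] Spinor)).holderL volume ∞ 2 2 (memLp_cutoffSymbol Λ).toLp

theorem symbolMul_ae (Λ : ℝ) (g : L2Spinor) :
    symbolMul Λ g =ᵐ[volume] fun ξ => cutoffSymbol Λ ξ (g ξ) := by
  have h := (ContinuousLinearMap.id ℂ (Spinor →L[ℂ] Spinor)).coeFn_holder (r := 2)
    (memLp_cutoffSymbol Λ).toLp g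
  filter_upwards [h, (memLp_cutoffSymbol Λ).coeFn_toLp] with ξ h1 h2
  have h3 : symbolMul Λ g ξ = (ContinuousLinearMap.id ℂ (Spinor →L[ℂ] Spinor)).holder 2
    (memLp_cutoffSymbol Λ).toLp g ξ := rfl
  rw [h3, h1, h2]; rfl

/-- The cut-off Dirac operator on `L²(ℝ³, ℂ⁴)`. -/
def diracL2 (Λ : ℝ) : L2Spinor →L[ℂ] L2Spinor :=
  (Lp.fourierTransformₗᵢ E3 Spinor).symm.toContinuousLinearEquiv.toContinuousLinearMap ∘L
    symbolMul Λ ∘L (Lp.fourierTransformₗᵢ E3 Spinor).toContinuousLinearEquiv.toContinuousLinearMap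

theorem fourier_diracL2 (Λ : ℝ) (f : L2Spinor) :
    (𝓕 (diracL2 Λ f) : L2Spinor) = symbolMul Λ (𝓕 f) :=
  (Lp.fourierTransformₗᵢ E3 Spinor).apply_symm_apply _

/-- The Dirac operator `D⁰ = -i α · ∇ + β`, restricted to the one-particle space: in Fourier space
it is the multiplication by `α · k + β`. -/
def dirac (Λ : ℝ) : OneParticle Λ →L[ℂ] OneParticle Λ :=
  (diracL2 Λ ∘L (oneParticleSpace Λ).subtypeL).codRestrict (oneParticleSpace Λ) (by
    intro f
    rw [mem_oneParticleSpace]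
    have h : (𝓕 ((diracL2 Λ ∘L (oneParticleSpace Λ).subtypeL) f) : L2Spinor) =
      symbolMul Λ (𝓕 (f : L2Spinor)) := fourier_diracL2 Λ f
    rw [h]
    filter_upwards [symbolMul_ae Λ (𝓕 (f : L2Spinor))] with ξ h1 h2
    rw [h1]
    simp [cutoffSymbol, h2])

theorem diracSymbol_isHermitian (p : E3) : (diracSymbol p).IsHermitian := by
  ext i j
  fin_cases i <;> fin_cases j <;>
    simp [diracSymbol, diracAlpha, diracBeta, pauli, Fin.sum_univ_three, finSumFinEquiv,
      Fin.addCases, Matrix.fromBlocks]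

theorem diracSymbol_sq (p : E3) : diracSymbol p * diracSymbol p = (1 + ‖p‖ ^ 2 : ℂ) • 1 := by
  have hp : (‖p‖ : ℂ) ^ 2 = (p 0 : ℂ) ^ 2 + (p 1 : ℂ) ^ 2 + (p 2 : ℂ) ^ 2 := by
    have := EuclideanSpace.real_norm_sq_eq p
    rw [Fin.sum_univ_three] at this
    exact_mod_cast this
  rw [hp]
  ext i j
  fin_cases i <;> fin_cases j <;>
    simp [diracSymbol, diracAlpha, diracBeta, pauli, Fin.sum_univ_three, Fin.sum_univ_four,
      finSumFinEquiv, Fin.addCases, Matrix.fromBlocks, Matrix.mul_apply] <;> ring_nf <;> simp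

theorem isSelfAdjoint_cutoffSymbol (Λ : ℝ) (ξ : E3) : IsSelfAdjoint (cutoffSymbol Λ ξ) := by
  by_cases h : ξ ∈ momentumBall Λ
  · simp only [cutoffSymbol, Set.indicator_of_mem h]
    exact (diracSymbol_isHermitian _).isSelfAdjoint.map (Matrix.toEuclideanCLM (n := Fin 4) (𝕜 := ℂ))
  · rw [show cutoffSymbol Λ ξ = 0 by simp [cutoffSymbol, h]]
    exact star_zero (Spinor →L[ℂ] Spinor)

theorem inner_dirac (Λ : ℝ) (f g : OneParticle Λ) :
    ⟪dirac Λ f, g⟫_ℂ = ∫ ξ,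
      ⟪cutoffSymbol Λ ξ ((𝓕 (f : L2Spinor) : L2Spinor) ξ), (𝓕 (g : L2Spinor) : L2Spinor) ξ⟫_ℂ := by
  have h : (𝓕 ((dirac Λ f : OneParticle Λ) : L2Spinor) : L2Spinor) =
      symbolMul Λ (𝓕 (f : L2Spinor)) := fourier_diracL2 Λ f
  rw [Submodule.coe_inner, ← Lp.inner_fourier_eq, h, L2.inner_def]
  refine integral_congr_ae ?_
  filter_upwards [symbolMul_ae Λ (𝓕 (f : L2Spinor))] with ξ h1
  rw [h1]

theorem inner_dirac_left (Λ : ℝ) (f g : OneParticle Λ) :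
    ⟪dirac Λ f, g⟫_ℂ = ⟪f, dirac Λ g⟫_ℂ := by
  rw [← inner_conj_symm f, inner_dirac, inner_dirac, ← integral_conj]
  refine integral_congr_ae (Filter.Eventually.of_forall fun ξ => ?_)
  have := (isSelfAdjoint_cutoffSymbol Λ ξ).isSymmetric
  simp only [inner_conj_symm]
  exact this _ _

/-- `D⁰` is self-adjoint. -/
theorem isSelfAdjoint_dirac (Λ : ℝ) : IsSelfAdjoint (dirac Λ) :=
  ContinuousLinearMap.isSelfAdjoint_iff_isSymmetric.2 (inner_dirac_left Λ)

theorem norm_le_dirac (Λ : ℝ) (f : OneParticle Λ) : ‖f‖ ≤ ‖dirac Λ f‖ := by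
  have h : (𝓕 ((dirac Λ f : OneParticle Λ) : L2Spinor) : L2Spinor) =
      symbolMul Λ (𝓕 (f : L2Spinor)) := fourier_diracL2 Λ f
  rw [Submodule.coe_norm, Submodule.coe_norm, ← Lp.norm_fourier_eq,
    ← Lp.norm_fourier_eq (dirac Λ f : L2Spinor), h]
  refine Lp.norm_le_norm_of_ae_le ?_
  filter_upwards [symbolMul_ae Λ (𝓕 (f : L2Spinor)), mem_oneParticleSpace.1 f.2] with ξ h1 h2
  rw [h1]
  by_cases hx : ξ ∈ momentumBall Λ
  · set v := (𝓕 (f : L2Spinor) : L2Spinor) ξ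
    have hs := (isSelfAdjoint_cutoffSymbol Λ ξ).isSymmetric v (cutoffSymbol Λ ξ v)
    have h3 : cutoffSymbol Λ ξ (cutoffSymbol Λ ξ v) = (1 + ‖(2 * Real.pi) • ξ‖ ^ 2 : ℂ) • v := by
      simp only [cutoffSymbol, Set.indicator_of_mem hx]
      rw [← mul_apply_eq_comp, ← map_mul, diracSymbol_sq, map_smul, map_one]
      simp
    simp only [ContinuousLinearMap.coe_coe] at hs
    rw [h3, inner_smul_right, inner_self_eq_norm_sq_to_K, inner_self_eq_norm_sq_to_K] at hs
    have hs' : ‖cutoffSymbol Λ ξ v‖ ^ 2 = (1 + ‖(2 * Real.pi) • ξ‖ ^ 2) * ‖v‖ ^ 2 := by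
      exact Complex.ofReal_injective (by push_cast; exact hs)
    refine le_of_sq_le_sq ?_ (norm_nonneg _)
    rw [hs']
    nlinarith [mul_nonneg (sq_nonneg ‖v‖) (sq_nonneg ‖(2 * Real.pi) • ξ‖)]
  · rw [h2 hx]; simp

theorem one_le_abs_of_norm_le {H : Type*} [NormedAddCommGroup H] [InnerProductSpace ℂ H] [CompleteSpace H]
    (A : H →L[ℂ] H) (hA : IsSelfAdjoint A) (h : ∀ f, ‖f‖ ≤ ‖A f‖) (x : ℝ)
    (hx : x ∈ spectrum ℝ A) : 1 ≤ |x| := by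
  have h1 : algebraMap ℝ (H →L[ℂ] H) 1 ≤ A ^ 2 := by
    rw [map_one, ContinuousLinearMap.le_def, ContinuousLinearMap.isPositive_iff_complex]
    intro f
    have e : ⟪A (A f), f⟫_ℂ = ⟪A f, A f⟫_ℂ := hA.isSymmetric (A f) f
    have e2 : ⟪(A ^ 2 - 1 : H →L[ℂ] H) f, f⟫_ℂ = ((‖A f‖ ^ 2 - ‖f‖ ^ 2 : ℝ) : ℂ) := by
      simp [pow_two, inner_sub_left, e, inner_self_eq_norm_sq_to_K]
    rw [e2]
    have := h f
    have := norm_nonneg f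
    have e3 : 0 ≤ ‖A f‖ ^ 2 - ‖f‖ ^ 2 := by nlinarith
    exact ⟨rfl, e3⟩
  have hsa : IsSelfAdjoint (A ^ 2) := hA.pow 2
  have h2 := (algebraMap_le_iff_le_spectrum (p := IsSelfAdjoint) (r := (1 : ℝ))
    (a := A ^ 2) hsa).1 h1
  have h3 := h2 (x ^ 2) (spectrum.pow_mem_pow A 2 hx)
  rw [← sq_abs] at h3
  nlinarith [abs_nonneg x]

/-- The spectrum of `D⁰` avoids `(-1, 1)`; in particular `spectralProjNeg (dirac Λ)` below is
a spectral projection. -/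
theorem one_le_abs_of_mem_spectrum_dirac (Λ : ℝ) (x : ℝ) (hx : x ∈ spectrum ℝ (dirac Λ)) :
    1 ≤ |x| :=
  one_le_abs_of_norm_le (dirac Λ) (isSelfAdjoint_dirac Λ) (norm_le_dirac Λ) x hx

/-- The spectral projection of a self-adjoint operator `A` on the negative half-line
`(-∞, 0)`, for `0` not in the spectrum of `A` (so that the indicator function is continuous on
the spectrum). -/
def spectralProjNeg {H : Type*} [NormedAddCommGroup H] [InnerProductSpace ℂ H] [CompleteSpace H]
    (A : H →L[ℂ] H) : H →L[ℂ] H :=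
  cfc (p := IsSelfAdjoint) (fun x : ℝ => if x < 0 then (1 : ℝ) else 0) A

/-- The free vacuum `P⁰₋`, the spectral projection of `D⁰` on the negative half-line. -/
def projNeg (Λ : ℝ) : OneParticle Λ →L[ℂ] OneParticle Λ := spectralProjNeg (dirac Λ)

/-- `P⁰₊ = 1 - P⁰₋`. -/
def projPos (Λ : ℝ) : OneParticle Λ →L[ℂ] OneParticle Λ := 1 - projNeg Λ

/-! ### Schatten classes and traces -/

section Trace

variable (H : Type*) [NormedAddCommGroup H] [InnerProductSpace ℂ H] [CompleteSpace H]

/-- The index set of a fixed Hilbert basis of `H`. -/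
def basisIndex : Set H := (exists_hilbertBasis ℂ H).choose

/-- A fixed Hilbert basis of `H`; nothing below depends on the choice. -/
def basis : HilbertBasis (basisIndex H) ℂ H := (exists_hilbertBasis ℂ H).choose_spec.choose

variable {H}

/-- The Schatten class `𝔖_p`: `tr |A|^p < ∞`, where the trace is a sum of non-negative terms. -/
def IsSchatten (p : ℕ) (A : H →L[ℂ] H) : Prop :=
  Summable fun i => RCLike.re ⟪basis H i, (CFC.abs A ^ p) (basis H i)⟫_ℂ

/-- The trace of a trace-class operator. -/
def opTrace (A : H →L[ℂ] H) : ℂ := ∑' i, ⟪basis H i, A (basis H i)⟫_ℂ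

end Trace

/-- Operators `Q` with `Q ∈ 𝔖₂` and `Q₊₊, Q₋₋ ∈ 𝔖₁`. -/
def IsGenTraceClass (Λ : ℝ) (Q : OneParticle Λ →L[ℂ] OneParticle Λ) : Prop :=
  IsSchatten 2 Q ∧ IsSchatten 1 (projPos Λ * Q * projPos Λ) ∧
    IsSchatten 1 (projNeg Λ * Q * projNeg Λ)

/-- The generalized trace `tr₀ A = tr (A₊₊ + A₋₋)`. -/
def genTrace (Λ : ℝ) (A : OneParticle Λ →L[ℂ] OneParticle Λ) : ℂ :=
  opTrace (projPos Λ * A * projPos Λ + projNeg Λ * A * projNeg Λ)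

/-- The convex set `𝒦` of admissible `Q`. -/
def admissible (Λ : ℝ) : Set (OneParticle Λ →L[ℂ] OneParticle Λ) :=
  {Q | IsGenTraceClass Λ Q ∧ IsSelfAdjoint Q ∧ -projNeg Λ ≤ Q ∧ Q ≤ 1 - projNeg Λ}

/-! ### The density -/

/-- In Fourier space, the evaluation at `x` of the component `a`. -/
def evalSymbol (Λ : ℝ) (x : E3) (a : Fin 4) (ξ : E3) : Spinor :=
  (momentumBall Λ).indicator
    (fun ξ => Complex.exp (-(2 * Real.pi * ⟪x, ξ⟫_ℝ : ℝ) * Complex.I) •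
      EuclideanSpace.single a (1 : ℂ)) ξ

theorem memLp_evalSymbol (Λ : ℝ) (x : E3) (a : Fin 4) :
    MemLp (evalSymbol Λ x a) 2 (volume : Measure E3) := by
  have hc : Continuous fun ξ : E3 => Complex.exp (-(2 * Real.pi * ⟪x, ξ⟫_ℝ : ℝ) * Complex.I) •
      (EuclideanSpace.single a (1 : ℂ) : Spinor) := by fun_prop
  have h := (hc.continuousOn (s := momentumBall Λ)).integrableOn_compact
    (μ := (volume : Measure E3)) (isCompact_momentumBall Λ)
  unfold evalSymbol
  rw [memLp_indicator_iff_restrict (isClosed_momentumBall Λ).measurableSet]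
  have hfin : IsFiniteMeasure ((volume : Measure E3).restrict (momentumBall Λ)) :=
    ⟨by simpa using (isCompact_momentumBall Λ).measure_lt_top⟩
  refine MemLp.of_bound hc.aestronglyMeasurable 1 (Filter.Eventually.of_forall fun ξ => ?_)
  rw [norm_smul, ← Complex.ofReal_neg, Complex.norm_exp_ofReal_mul_I]
  simp

/-- The element `δ_{x,a}` of the one-particle space with Fourier transform
`1(2π|ξ| ≤ Λ) exp (-2πi⟨x, ξ⟩) e_a`. It represents the evaluation of the `a`-th component at `x`:
`⟪δ_{x,a}, f⟫ = (f x) a` for the continuous representative of `f` (see `inner_evalVec`). -/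
def evalVec (Λ : ℝ) (x : E3) (a : Fin 4) : OneParticle Λ :=
  ⟨(𝓕⁻ ((memLp_evalSymbol Λ x a).toLp : L2Spinor) : L2Spinor), by
    rw [mem_oneParticleSpace, FourierTransform.fourier_fourierInv_eq]
    filter_upwards [(memLp_evalSymbol Λ x a).coeFn_toLp] with ξ h1 h2
    rw [h1]
    simp [evalSymbol, h2]⟩

/-- Fourier inversion: the inner product with `δ_{x,a}` is the value at `x` of the `a`-th component
of the inverse Fourier integral of `𝓕 f`. -/
theorem inner_evalVec (Λ : ℝ) (x : E3) (a : Fin 4) (f : OneParticle Λ) :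
    ⟪evalVec Λ x a, f⟫_ℂ = ∫ ξ in momentumBall Λ,
      Complex.exp ((2 * Real.pi * ⟪x, ξ⟫_ℝ : ℝ) * Complex.I) * (𝓕 (f : L2Spinor) : L2Spinor) ξ a := by
  have h0 : ⟪evalVec Λ x a, f⟫_ℂ =
      ⟪((memLp_evalSymbol Λ x a).toLp : L2Spinor), (𝓕 (f : L2Spinor) : L2Spinor)⟫_ℂ := by
    rw [Submodule.coe_inner, ← Lp.inner_fourier_eq]
    simp only [evalVec, FourierTransform.fourier_fourierInv_eq]
  rw [h0, L2.inner_def, ← integral_indicator (isClosed_momentumBall Λ).measurableSet]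
  refine integral_congr_ae ?_
  filter_upwards [(memLp_evalSymbol Λ x a).coeFn_toLp] with ξ h1
  rw [h1]
  by_cases h : ξ ∈ momentumBall Λ
  · simp only [evalSymbol, Set.indicator_of_mem h, inner_smul_left, EuclideanSpace.inner_single_left]
    rw [← Complex.exp_conj, map_mul, map_neg, Complex.conj_ofReal, Complex.conj_I]
    simp
  · simp [evalSymbol, h]

/-- The smooth `4 × 4` matrix kernel `Q(x, y)` of `Q`: as `⟪δ_{x,a}, Q f⟫ = ((Q f) x) a`,
one has `Q(x, y)_{ab} = ⟪δ_{x,a}, Q δ_{y,b}⟫`. -/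
def kernel (Λ : ℝ) (Q : OneParticle Λ →L[ℂ] OneParticle Λ) (x y : E3) :
    Matrix (Fin 4) (Fin 4) ℂ :=
  Matrix.of fun a b => ⟪evalVec Λ x a, Q (evalVec Λ y b)⟫_ℂ

/-- The density `ρ_Q(x) = tr_{ℂ⁴} Q(x, x)`. -/
def density (Λ : ℝ) (Q : OneParticle Λ →L[ℂ] OneParticle Λ) (x : E3) : ℂ :=
  (kernel Λ Q x x).trace

/-! ### The Coulomb space -/

/-- The tempered distribution `T` is given by the function `f`. -/
def RepresentedBy (T : 𝓢'(E3, ℂ)) (f : E3 → ℂ) : Prop :=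
  ∀ φ : 𝓢(E3, ℂ), Integrable (fun x => φ x * f x) ∧ T φ = ∫ x, φ x * f x

open Classical in
/-- The tempered distribution given by a function `f` (`0` if there is none). -/
def toDistribution (f : E3 → ℂ) : 𝓢'(E3, ℂ) :=
  if h : ∃ T : 𝓢'(E3, ℂ), RepresentedBy T f then h.choose else 0

/-- The Fourier transform of `T`, in the normalization
`(2π)^{-3/2} ∫ T(x) exp (-i⟨k, x⟩) dx`, is the function `g`. In terms of Mathlib's Fourier
transform this means that `𝓕 T` is the function `ξ ↦ (2π)^{3/2} g(2πξ)`. -/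
def HasFourierTransform (T : 𝓢'(E3, ℂ)) (g : E3 → ℂ) : Prop :=
  RepresentedBy (𝓕 T) fun ξ => ((2 * Real.pi) ^ (3 / 2 : ℝ) : ℝ) * g ((2 * Real.pi) • ξ)

/-- The Coulomb space of all tempered distributions `T` whose Fourier transform is a function with
`∫ |T̂(k)|² / |k|² dk < ∞`. -/
def coulombSpace : Set 𝓢'(E3, ℂ) :=
  {T | ∃ g : E3 → ℂ, HasFourierTransform T g ∧ Integrable fun k => ‖g k‖ ^ 2 / ‖k‖ ^ 2}

open Classical in
/-- The Fourier transform (a function, unique almost everywhere) of an element of the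
Coulomb space. -/
def coulombHat (T : 𝓢'(E3, ℂ)) : E3 → ℂ :=
  if h : T ∈ coulombSpace then h.choose else 0

/-- The Coulomb inner product, `D(ρ₁, ρ₂) = 4π ∫ ρ̂₁(k) conj(ρ̂₂(k)) / |k|² dk`, which is
`∬ ρ₁(x) ρ₂(y) / |x - y| dx dy` for nice real functions. -/
def coulombInner (T₁ T₂ : 𝓢'(E3, ℂ)) : ℂ :=
  4 * Real.pi * ∫ k, coulombHat T₁ k * (starRingEnd ℂ) (coulombHat T₂ k) / (‖k‖ ^ 2 : ℝ)

/-! ### The energy -/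

/-- The rBDF energy of `Q` in the external density `ν`, with coupling constant `α`:
`tr₀(D⁰ Q) - α D(ρ_Q, ν) + (α / 2) D(ρ_Q, ρ_Q)`. It is real on admissible `Q` and real `ν`. -/
def energy (α Λ : ℝ) (ν : E3 → ℝ) (Q : OneParticle Λ →L[ℂ] OneParticle Λ) : ℝ :=
  (genTrace Λ (dirac Λ * Q)
    - α * coulombInner (toDistribution (density Λ Q)) (toDistribution fun x => (ν x : ℂ))
    + α / 2 * coulombInner (toDistribution (density Λ Q)) (toDistribution (density Λ Q))).re

/-- The ground state energy `E(Z) = inf {ℰ^{Zν}(Q) : Q ∈ 𝒦}`. The infimum is taken in the extended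
reals, so it is `⊥` if the energy is not bounded from below. -/
def groundStateEnergy (α Λ : ℝ) (ν : E3 → ℝ) (Z : ℝ) : EReal :=
  ⨅ Q ∈ admissible Λ, ((energy α Λ (fun x => Z * ν x) Q : ℝ) : EReal)

/-- The constant `c₂ = 2^{-4/3} 3^{2/3} π^{-1/3}`. -/
def c₂ : ℝ := (2 : ℝ) ^ (-(4 / 3) : ℝ) * (3 : ℝ) ^ (2 / 3 : ℝ) * Real.pi ^ (-(1 / 3) : ℝ)

end RBDF

end

noncomputable section

namespace RBDF

/-! The kinetic energy is non-negative: for admissible `Q` the block `Q₊₊` is positive and `Q₋₋`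
negative, so both diagonal blocks of `D⁰Q` have the form (positive part of ±`D⁰`) times (positive
trace-class operator); see `re_opTrace_diag_mul_nonneg`. It remains to absorb the attraction into
the Coulomb self-energy.

The momentum cutoff makes densities bounded. A chirality matrix anticommuting with `D⁰` interchanges
`P⁰₋` and `P⁰₊` without changing densities, so each has half the density of the identity, and `-P⁰₋
≤ Q ≤ P⁰₊` gives `|ρ_Q| ≤ M = Λ³/(3π²)` (`norm_density_le`).

For `f` of L¹-norm `Z`, the interaction `D(ρ, f)` is split in Fourier space by a Gaussian at heat
time `s` (`re_coulombInner_le`). The smoothed part is at most `D(ρ, ρ)/2 + Z²/√(2s)` by Young's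
inequality, and the energy contains exactly `D(ρ, ρ)/2` to compensate. The remainder is an integral
over `0 < t ≤ s` of heat-regularized pairings, each at most `M Z` because the heat flow contracts
the supremum norm. Optimizing `Z²/√(2s) + s M Z` over `s` (`exists_scale`) yields a multiple of `Λ
Z^{5/3}` with a constant below `c₂`. -/

/-! ### Modulated Gaussians as Schwartz functions -/

theorem norm_iteratedFDeriv_cexp_le (n : ℕ) (z : ℂ) :
    ‖iteratedFDeriv ℝ n Complex.exp z‖ ≤ Real.exp z.re := by
  induction n generalizing z with
  | zero => rw [norm_iteratedFDeriv_zero, Complex.norm_exp]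
  | succ n ih =>
    let L : ℂ →L[ℝ] (ℂ →L[ℝ] ℂ) := ContinuousLinearMap.mul ℝ ℂ
    -- The exponential is its own derivative up to `L`, which has norm at most one, so the induction
    -- accumulates no constants.
    have h : fderiv ℝ Complex.exp = L ∘ Complex.exp := by
      funext z
      have h1 := ((Complex.hasDerivAt_exp z).hasFDerivAt.restrictScalars ℝ).fderiv
      rw [h1]
      ext; simp [L, mul_comm]
    rw [← norm_iteratedFDeriv_fderiv, h]
    refine (L.norm_iteratedFDeriv_comp_left (n := n) (N := n)
      (Complex.contDiff_exp.contDiffAt) le_rfl).trans ?_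
    refine (mul_le_of_le_one_left (norm_nonneg _) ?_).trans (ih z)
    exact ContinuousLinearMap.opNorm_mul_le ℝ ℂ

/-- Powers times a Gaussian are bounded. -/
theorem exists_pow_mul_gaussian_le {b : ℝ} (hb : 0 < b) (N : ℕ) :
    ∃ C : ℝ, ∀ r : ℝ, 0 ≤ r → (1 + r) ^ N * Real.exp (-b * r ^ 2) ≤ C := by
  -- From `1 + r ≤ 2(1 + r²)` and `y^N / N! ≤ e^y` at `y = b(1 + r²)`; the summand 1 in `1 + r²`
  -- leaves the factor `e^b`.
  refine ⟨2 ^ N * (N.factorial * Real.exp b / b ^ N), fun r hr => ?_⟩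
  have h1 : (1 + r) ^ N ≤ 2 ^ N * (1 + r ^ 2) ^ N := by
    rw [← mul_pow]
    gcongr
    nlinarith [sq_nonneg (r - 1)]
  have h2 := Real.pow_div_factorial_le_exp (b * (1 + r ^ 2)) (by positivity) N
  have h3 : (1 + r ^ 2) ^ N ≤ N.factorial * Real.exp (b * (1 + r ^ 2)) / b ^ N := by
    rw [le_div_iff₀ (by positivity), ← mul_pow, mul_comm _ b]
    rwa [div_le_iff₀' (by positivity)] at h2
  have h4 : Real.exp (b * (1 + r ^ 2)) * Real.exp (-b * r ^ 2) = Real.exp b := by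
    rw [← Real.exp_add]; ring_nf
  calc _ ≤ 2 ^ N * (N.factorial * Real.exp (b * (1 + r ^ 2)) / b ^ N) * Real.exp (-b * r ^ 2) := by
        gcongr
        exact h1.trans (by gcongr)
    _ = 2 ^ N * (N.factorial * (Real.exp (b * (1 + r ^ 2)) * Real.exp (-b * r ^ 2)) / b ^ N) := by
        ring
    _ = _ := by rw [h4]

/-- The exponent has temperate growth, so by the composition bound each derivative is at most a
polynomial times `exp (-b‖v‖²)`. -/
theorem exists_iteratedFDeriv_gaussian_le {b : ℝ} (hb : 0 < b) (x : E3) (k n : ℕ) :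
    ∃ C : ℝ, ∀ v : E3, ‖v‖ ^ k * ‖iteratedFDeriv ℝ n
      (fun v : E3 => Complex.exp (-b * ‖v‖ ^ 2 + 2 * Real.pi * Complex.I * ⟪x, v⟫_ℝ)) v‖ ≤ C := by
  set f : E3 → ℂ := fun v => -b * ‖v‖ ^ 2 + 2 * Real.pi * Complex.I * ⟪x, v⟫_ℝ with hf
  have hg : f.HasTemperateGrowth := by
    have h1 : (fun v : E3 => ‖v‖ ^ 2).HasTemperateGrowth := by fun_prop
    have h2 : (fun v : E3 => ⟪x, v⟫_ℝ).HasTemperateGrowth := by fun_prop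
    have h1' := Function.HasTemperateGrowth.comp Function.Complex.hasTemperateGrowth_ofReal h1
    have h2' := Function.HasTemperateGrowth.comp Function.Complex.hasTemperateGrowth_ofReal h2
    have e : f = fun v => -(b : ℂ) * ((‖v‖ ^ 2 : ℝ) : ℂ) +
        2 * Real.pi * Complex.I * (⟪x, v⟫_ℝ : ℝ) := by
      funext v; simp [hf]
    rw [e]
    exact ((Function.HasTemperateGrowth.const _).mul h1').add
      ((Function.HasTemperateGrowth.const _).mul h2')
  obtain ⟨m, C, hC, hbd⟩ := hg.norm_iteratedFDeriv_le_uniform n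
  obtain ⟨B, hB⟩ := exists_pow_mul_gaussian_le hb (k + m * n)
  refine ⟨n.factorial * (C + 1) ^ n * B, fun v => ?_⟩
  -- The composition bound wants the `i`-th derivative of `f` below `D ^ i`. Taking `C + 1` in place
  -- of `C` ensures `D ≥ 1`, hence `D ≤ D ^ i` for `i ≥ 1`.
  have h := norm_iteratedFDeriv_comp_le (g := Complex.exp) (f := f) (n := n) (N := n)
    Complex.contDiff_exp (hg.1.of_le (by exact_mod_cast le_top)) le_rfl v
    (C := Real.exp (f v).re) (D := (C + 1) * (1 + ‖v‖) ^ m)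
    (fun i _ => norm_iteratedFDeriv_cexp_le i _) (fun i hi hin => by
      have h1 : 1 ≤ (1 + ‖v‖) ^ m := one_le_pow₀ (by linarith [norm_nonneg v])
      have h2 : 1 ≤ (C + 1) * (1 + ‖v‖) ^ m := by nlinarith
      refine (hbd i hin v).trans (le_trans ?_ (le_self_pow₀ h2 (by omega)))
      nlinarith)
  have hre : (f v).re = -b * ‖v‖ ^ 2 := by
    simp [hf, ← Complex.ofReal_pow]
  have h3 : ‖v‖ ^ k ≤ (1 + ‖v‖) ^ k := by gcongr; linarith
  calc _ ≤ (1 + ‖v‖) ^ k * (n.factorial * Real.exp (f v).re * ((C + 1) * (1 + ‖v‖) ^ m) ^ n) := by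
        gcongr; exact h
    _ = n.factorial * (C + 1) ^ n * ((1 + ‖v‖) ^ (k + m * n) * Real.exp (-b * ‖v‖ ^ 2)) := by
        rw [hre, mul_pow, ← pow_mul, pow_add]; ring
    _ ≤ _ := by gcongr; exact hB _ (norm_nonneg v)

/-- The modulated Gaussian as a Schwartz function. -/
def gaussianSchwartz {b : ℝ} (hb : 0 < b) (x : E3) : 𝓢(E3, ℂ) where
  toFun v := Complex.exp (-b * ‖v‖ ^ 2 + 2 * Real.pi * Complex.I * ⟪x, v⟫_ℝ)
  smooth' := by
    refine Complex.contDiff_exp.comp ?_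
    have h1 : ContDiff ℝ ((⊤ : ℕ∞) : WithTop ℕ∞) fun v : E3 => ((‖v‖ ^ 2 : ℝ) : ℂ) :=
      Complex.ofRealCLM.contDiff.comp (contDiff_norm_sq ℝ)
    have h2 : ContDiff ℝ ((⊤ : ℕ∞) : WithTop ℕ∞) fun v : E3 => ((⟪x, v⟫_ℝ : ℝ) : ℂ) :=
      Complex.ofRealCLM.contDiff.comp (contDiff_const.inner ℝ contDiff_id)
    simp only [Complex.ofReal_pow] at h1
    exact (contDiff_const.mul h1).add (contDiff_const.mul h2)
  decay' := exists_iteratedFDeriv_gaussian_le hb x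

theorem gaussianSchwartz_apply {b : ℝ} (hb : 0 < b) (x v : E3) : gaussianSchwartz hb x v =
    Complex.exp (-b * ‖v‖ ^ 2 + 2 * Real.pi * Complex.I * ⟪x, v⟫_ℝ) := rfl

/-! ### Tempered distributions given by functions -/

/-- Multiplying `f - g` by a nowhere vanishing Gaussian makes it integrable. A compactly supported
smooth function times that Gaussian is again Schwartz, so the fundamental lemma of the calculus of
variations applies to the product. -/
theorem RepresentedBy.ae_eq {T : 𝓢'(E3, ℂ)} {f g : E3 → ℂ} (hf : RepresentedBy T f)
    (hg : RepresentedBy T g) : f =ᵐ[volume] g := by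
  set φ : 𝓢(E3, ℂ) := gaussianSchwartz one_pos 0 with hφ
  have hi : Integrable fun x => φ x * (f x - g x) := by
    refine ((hf φ).1.sub (hg φ).1).congr (Filter.Eventually.of_forall fun x => ?_)
    simp [mul_sub]
  have h0 : ∀ᵐ x, φ x * (f x - g x) = 0 := by
    refine ae_eq_zero_of_integral_contDiff_smul_eq_zero hi.locallyIntegrable fun u hu hc => ?_
    have hc' : HasCompactSupport (Complex.ofRealCLM ∘ u) := hc.comp_left rfl
    have hu' : ContDiff ℝ ((⊤ : ℕ∞) : WithTop ℕ∞) (Complex.ofRealCLM ∘ u) := by fun_prop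
    have ht := hc'.hasTemperateGrowth hu'
    set ψ : 𝓢(E3, ℂ) := SchwartzMap.smulLeftCLM ℂ (Complex.ofRealCLM ∘ u) φ with hψ
    have e : ∀ x, u x • (φ x * (f x - g x)) = ψ x * f x - ψ x * g x := by
      intro x
      rw [hψ, SchwartzMap.smulLeftCLM_apply_apply ht]
      simp
      ring
    simp_rw [e]
    rw [integral_sub (hf ψ).1 (hg ψ).1, ← (hf ψ).2, ← (hg ψ).2, sub_self]
  filter_upwards [h0] with x hx
  have hne : φ x ≠ 0 := Complex.exp_ne_zero _
  exact sub_eq_zero.1 ((mul_eq_zero.1 hx).resolve_left hne)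

theorem RepresentedBy.eq {T T' : 𝓢'(E3, ℂ)} {f : E3 → ℂ} (h : RepresentedBy T f)
    (h' : RepresentedBy T' f) : T = T' := by
  ext φ
  rw [(h φ).2, (h' φ).2]

theorem RepresentedBy.toDistribution_eq {T : 𝓢'(E3, ℂ)} {f : E3 → ℂ} (h : RepresentedBy T f) :
    toDistribution f = T := by
  have hex : ∃ T : 𝓢'(E3, ℂ), RepresentedBy T f := ⟨T, h⟩
  rw [toDistribution, dif_pos hex]
  exact hex.choose_spec.eq h

/-- An integrable function defines a tempered distribution, whose Fourier transform is given by
the Fourier integral. -/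
theorem exists_representedBy_of_integrable {f : E3 → ℂ} (hf : Integrable f) :
    ∃ T : 𝓢'(E3, ℂ), RepresentedBy T f ∧ RepresentedBy (𝓕 T) (𝓕 f) := by
  have hint : ∀ φ : 𝓢(E3, ℂ), Integrable fun x => φ x * f x := fun φ =>
    hf.bdd_mul φ.continuous.aestronglyMeasurable
      (Filter.Eventually.of_forall fun x => φ.norm_le_seminorm ℝ x)
  have hint' : ∀ φ : 𝓢(E3, ℂ), Integrable fun x => φ x * 𝓕 f x := fun φ =>
    φ.integrable.mul_bdd (c := ∫ v, ‖f v‖)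
      (VectorFourier.fourierIntegral_continuous Real.continuous_fourierChar
        continuous_inner hf).aestronglyMeasurable
      (Filter.Eventually.of_forall fun x => VectorFourier.norm_fourierIntegral_le_integral_norm _ _ _ f x)
  refine ⟨((memLp_one_iff_integrable.2 hf).toLp f : Lp ℂ 1 volume), ?_, ?_⟩
  · intro φ
    refine ⟨hint φ, ?_⟩
    rw [Lp.toTemperedDistribution_apply]
    refine integral_congr_ae ?_
    filter_upwards [(memLp_one_iff_integrable.2 hf).coeFn_toLp] with x hx
    rw [hx, smul_eq_mul]
  · intro φ
    refine ⟨hint' φ, ?_⟩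
    rw [TemperedDistribution.fourier_apply, Lp.toTemperedDistribution_apply]
    have h1 : ∫ x, (𝓕 φ : 𝓢(E3, ℂ)) x • ((memLp_one_iff_integrable.2 hf).toLp f : Lp ℂ 1 volume) x
        = ∫ x, 𝓕 (φ : E3 → ℂ) x • f x := by
      refine integral_congr_ae ?_
      filter_upwards [(memLp_one_iff_integrable.2 hf).coeFn_toLp] with x hx
      rw [hx, SchwartzMap.fourier_coe]
    rw [h1]
    have := VectorFourier.integral_fourierIntegral_smul_eq_flip (μ := (volume : Measure E3))
      (ν := (volume : Measure E3)) (L := innerₗ E3) (e := Real.fourierChar) (f := (φ : E3 → ℂ)) (g := f) Real.continuous_fourierChar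
      continuous_inner φ.integrable hf
    rw [flip_innerₗ] at this
    exact this

/-! ### Heat-kernel estimates -/

theorem norm_fourier_gaussianSchwartz {t : ℝ} (ht : 0 < t) (y w : E3) :
    ‖(𝓕 (gaussianSchwartz (mul_pos Real.pi_pos ht) y) : 𝓢(E3, ℂ)) w‖ =
      (1 / t) ^ (3 / 2 : ℝ) * Real.exp (-(Real.pi / t) * ‖w - y‖ ^ 2) := by
  have hb : 0 < ((Real.pi * t : ℝ) : ℂ).re := by simpa using mul_pos Real.pi_pos ht
  have h := fourier_gaussian_innerProductSpace' hb y w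
  rw [SchwartzMap.fourier_coe]
  have e : (gaussianSchwartz (mul_pos Real.pi_pos ht) y : E3 → ℂ) = fun v =>
    Complex.exp (-((Real.pi * t : ℝ) : ℂ) * ‖v‖ ^ 2 + 2 * Real.pi * Complex.I * ⟪y, v⟫_ℝ) := rfl
  rw [e, h, norm_mul, Complex.norm_exp]
  congr 1
  · rw [← Complex.ofReal_div, Complex.norm_cpow_eq_rpow_re_of_pos (by positivity)]
    congr 1
    · field_simp
    · simp
  · congr 1
    rw [norm_sub_rev]
    norm_cast
    field_simp

/-- The heat kernel centred at `y` is a probability density; this is why the heat flow contracts the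
supremum norm. -/
theorem integral_norm_fourier_gaussianSchwartz {t : ℝ} (ht : 0 < t) (y : E3) :
    ∫ w, ‖(𝓕 (gaussianSchwartz (mul_pos Real.pi_pos ht) y) : 𝓢(E3, ℂ)) w‖ = 1 := by
  simp_rw [norm_fourier_gaussianSchwartz ht]
  rw [integral_const_mul,
    integral_sub_right_eq_self (fun w : E3 => Real.exp (-(Real.pi / t) * ‖w‖ ^ 2)) y,
    GaussianFourier.integral_rexp_neg_mul_sq_norm (by positivity)]
  have : Real.pi / (Real.pi / t) = t := by field_simp
  rw [this, finrank_euclideanSpace, Fintype.card_fin, Nat.cast_ofNat,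
   ← Real.mul_rpow (by positivity) (by positivity),
    one_div_mul_cancel ht.ne', Real.one_rpow]

/-- A bounded function, tested in Fourier space against a modulated Gaussian. -/
theorem norm_integral_mul_gaussian_le {T : 𝓢'(E3, ℂ)} {ρ h : E3 → ℂ} {M : ℝ}
    (hρ : RepresentedBy T ρ) (hM : ∀ x, ‖ρ x‖ ≤ M) (hh : RepresentedBy (𝓕 T) h) {t : ℝ}
    (ht : 0 < t) (y : E3) :
    ‖∫ ξ, gaussianSchwartz (mul_pos Real.pi_pos ht) y ξ * h ξ‖ ≤ M := by
  -- The Fourier transform moves from the distribution to the Gaussian, turning the integral into an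
  -- average of `ρ` against a heat kernel.
  rw [← (hh _).2, TemperedDistribution.fourier_apply, (hρ _).2]
  set ψ : 𝓢(E3, ℂ) := 𝓕 (gaussianSchwartz (mul_pos Real.pi_pos ht) y)
  refine (norm_integral_le_of_norm_le (g := fun x => M * ‖ψ x‖)
    (ψ.integrable.norm.const_mul M) (Filter.Eventually.of_forall fun x => ?_)).trans ?_
  · rw [norm_mul, mul_comm]
    gcongr
    exact hM x
  · rw [integral_const_mul, integral_norm_fourier_gaussianSchwartz ht, mul_one]

/-- In polar coordinates the three-dimensional Jacobian `r²` cancels the singularity, leaving a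
one-dimensional Gaussian. -/
theorem integrable_gaussian_div_norm_sq {c : ℝ} (hc : 0 < c) :
    Integrable fun ξ : E3 => Real.exp (-c * ‖ξ‖ ^ 2) / ‖ξ‖ ^ 2 := by
  rw [integrable_fun_norm_addHaar (μ := (volume : Measure E3))
    (f := fun r : ℝ => Real.exp (-c * r ^ 2) / r ^ 2)]
  refine ((integrable_exp_neg_mul_sq hc).integrableOn (s := Set.Ioi 0)).congr_fun
    (fun r (hr : 0 < r) => ?_) measurableSet_Ioi
  simp only [finrank_euclideanSpace, Fintype.card_fin, smul_eq_mul]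
  field_simp

theorem integral_gaussian_div_norm_sq (c : ℝ) :
    ∫ ξ : E3, Real.exp (-c * ‖ξ‖ ^ 2) / ‖ξ‖ ^ 2 = 2 * Real.pi * √(Real.pi / c) := by
  rw [integral_fun_norm_addHaar (volume : Measure E3) (fun r : ℝ => Real.exp (-c * r ^ 2) / r ^ 2)]
  have h : ∫ r in Set.Ioi (0 : ℝ), r ^ (Module.finrank ℝ E3 - 1) • (Real.exp (-c * r ^ 2) / r ^ 2)
      = ∫ r in Set.Ioi (0 : ℝ), Real.exp (-c * r ^ 2) := by
    refine setIntegral_congr_fun measurableSet_Ioi fun r (hr : 0 < r) => ?_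
    simp only [finrank_euclideanSpace, Fintype.card_fin, smul_eq_mul]
    field_simp
  rw [h, integral_gaussian_Ioi, Measure.real, EuclideanSpace.volume_ball_fin_three]
  rw [ENNReal.toReal_mul, ENNReal.toReal_pow, ENNReal.toReal_ofReal (by positivity),
    ENNReal.toReal_ofReal (by positivity)]
  simp
  ring

theorem integral_exp_neg_mul_Ioc {a s : ℝ} (ha : a ≠ 0) (hs : 0 ≤ s) :
    ∫ t in Set.Ioc 0 s, Real.exp (-a * t) = (1 - Real.exp (-a * s)) / a := by
  rw [← intervalIntegral.integral_of_le hs]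
  rw [intervalIntegral.integral_comp_mul_left (fun t => Real.exp t) (neg_ne_zero.2 ha), integral_exp]
  simp
  field_simp
  ring

/-- A bound for the short-distance part, from bounds for the heat flow. -/
theorem norm_integral_mul_one_sub_gaussian_div_le {H : E3 → ℂ} {B s : ℝ} (hs : 0 < s)
    (hH : Integrable fun ξ => H ξ / (‖ξ‖ ^ 2 : ℝ))
    (hB : ∀ t, 0 < t → ‖∫ ξ, H ξ * Real.exp (-(Real.pi * t) * ‖ξ‖ ^ 2)‖ ≤ B) :
    ‖∫ ξ, H ξ / (‖ξ‖ ^ 2 : ℝ) * (1 - Real.exp (-(Real.pi * s) * ‖ξ‖ ^ 2) : ℝ)‖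
      ≤ Real.pi * s * B := by
  have hne : ∀ᵐ ξ : E3, ξ ≠ 0 := by
    simp [ae_iff]
  -- Only `H ξ / ‖ξ‖²` is assumed integrable; `H` is recovered from it off the null set `{0}`.
  have hHm : AEStronglyMeasurable H volume := by
    have h1 : AEStronglyMeasurable (fun ξ : E3 => H ξ / (‖ξ‖ ^ 2 : ℝ) * ((‖ξ‖ ^ 2 : ℝ) : ℂ)) volume :=
      hH.1.mul (by fun_prop)
    refine h1.congr ?_
    filter_upwards [hne] with ξ hξ
    rw [div_mul_cancel₀]
    exact_mod_cast pow_ne_zero 2 (norm_ne_zero_iff.2 hξ)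
  -- The short-distance Coulomb multiplier is `π` times a superposition of heat multipliers at times
  -- up to `s`.
  have hkey : ∀ ξ : E3, ξ ≠ 0 → ∫ t in Set.Ioc 0 s, Real.exp (-(Real.pi * t) * ‖ξ‖ ^ 2) =
      (1 - Real.exp (-(Real.pi * s) * ‖ξ‖ ^ 2)) / (Real.pi * ‖ξ‖ ^ 2) := by
    intro ξ hξ
    have hξ' := norm_ne_zero_iff.2 hξ
    have h := integral_exp_neg_mul_Ioc (a := Real.pi * ‖ξ‖ ^ 2) (s := s)
      (by positivity) hs.le
    convert h using 2
    · funext t; ring_nf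
    · ring_nf
  have hexp : ∀ (t : ℝ) (ξ : E3), 0 ≤ t → Real.exp (-(Real.pi * t) * ‖ξ‖ ^ 2) ≤ 1 := by
    intro t ξ ht
    rw [Real.exp_le_one_iff]
    have : 0 ≤ Real.pi * t * ‖ξ‖ ^ 2 := by positivity
    linarith
  -- For Fubini: the `t`-integral of the norm is at most `π⁻¹ ‖H ξ‖ / ‖ξ‖²`.
  have hint : Integrable (Function.uncurry fun (ξ : E3) (t : ℝ) =>
      H ξ * Real.exp (-(Real.pi * t) * ‖ξ‖ ^ 2))
      ((volume : Measure E3).prod (volume.restrict (Set.Ioc 0 s))) := by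
    have hm : AEStronglyMeasurable (Function.uncurry fun (ξ : E3) (t : ℝ) =>
      H ξ * Real.exp (-(Real.pi * t) * ‖ξ‖ ^ 2))
      ((volume : Measure E3).prod (volume.restrict (Set.Ioc 0 s))) := by
      refine AEStronglyMeasurable.mul (hHm.comp_fst) ?_
      exact Continuous.aestronglyMeasurable (by fun_prop)
    rw [integrable_prod_iff hm]
    refine ⟨Filter.Eventually.of_forall fun ξ => ?_, ?_⟩
    · have hc : Continuous fun t : ℝ => H ξ * Real.exp (-(Real.pi * t) * ‖ξ‖ ^ 2) := by fun_prop
      exact hc.integrableOn_Ioc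
    · refine (hH.norm.const_mul Real.pi⁻¹).mono' (hm.norm.integral_prod_right') ?_
      filter_upwards [hne] with ξ hξ
      simp only [Function.uncurry_apply_pair, norm_mul, Complex.norm_real, Real.norm_eq_abs,
        Real.abs_exp, norm_div]
      rw [integral_const_mul, hkey ξ hξ, abs_of_nonneg, abs_of_nonneg]
      · have h1 := Real.exp_pos (-(Real.pi * s) * ‖ξ‖ ^ 2)
        have hξ' := norm_ne_zero_iff.2 hξ
        have hp : 0 < ‖ξ‖ ^ 2 := by positivity
        calc _ = Real.pi⁻¹ * (‖H ξ‖ / ‖ξ‖ ^ 2) * (1 - Real.exp (-(Real.pi * s) * ‖ξ‖ ^ 2)) := by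
              field_simp
          _ ≤ _ := mul_le_of_le_one_right (by positivity) (by linarith)
      · positivity
      · refine mul_nonneg (norm_nonneg _) (div_nonneg ?_ (by positivity))
        linarith [hexp s ξ hs.le]
  have e1 : ∫ ξ, H ξ / (‖ξ‖ ^ 2 : ℝ) * (1 - Real.exp (-(Real.pi * s) * ‖ξ‖ ^ 2) : ℝ) =
      Real.pi * ∫ ξ, ∫ t in Set.Ioc 0 s, H ξ * Real.exp (-(Real.pi * t) * ‖ξ‖ ^ 2) := by
    rw [← integral_const_mul]
    refine integral_congr_ae ?_
    filter_upwards [hne] with ξ hξ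
    rw [integral_const_mul, integral_complex_ofReal, hkey ξ hξ]
    have hξ' := norm_ne_zero_iff.2 hξ
    have h2 : ((‖ξ‖ : ℝ) : ℂ) ≠ 0 := by exact_mod_cast hξ'
    have h3 : (Real.pi : ℂ) ≠ 0 := by exact_mod_cast Real.pi_ne_zero
    push_cast
    field_simp
  rw [e1, integral_integral_swap hint, norm_mul, Complex.norm_real, Real.norm_eq_abs,
    abs_of_pos Real.pi_pos, mul_assoc]
  gcongr
  have h4 := norm_setIntegral_le_of_norm_le_const (μ := volume) (s := Set.Ioc 0 s) (C := B)
    (f := fun t => ∫ ξ, H ξ * Real.exp (-(Real.pi * t) * ‖ξ‖ ^ 2)) (by simp)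
    (fun t ht => hB t ht.1)
  refine h4.trans_eq ?_
  simp [Measure.real, hs.le, mul_comm]

/-- The heat-regularized pairing of a bounded function with an integrable function. -/
theorem norm_integral_mul_conj_fourier_mul_gaussian_le {T : 𝓢'(E3, ℂ)} {ρ h f : E3 → ℂ} {M : ℝ}
    (hρ : RepresentedBy T ρ) (hM : ∀ x, ‖ρ x‖ ≤ M) (hh : RepresentedBy (𝓕 T) h)
    (hf : Integrable f) {t : ℝ} (ht : 0 < t) :
    ‖∫ ξ, h ξ * (starRingEnd ℂ) (𝓕 f ξ) * Real.exp (-(Real.pi * t) * ‖ξ‖ ^ 2)‖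
      ≤ M * ∫ y, ‖f y‖ := by
  set G := gaussianSchwartz (mul_pos Real.pi_pos ht)
  have e0 : ∀ y ξ, G y ξ = Real.exp (-(Real.pi * t) * ‖ξ‖ ^ 2) *
      Complex.exp (2 * Real.pi * Complex.I * ⟪y, ξ⟫_ℝ) := by
    intro y ξ
    simp only [G, gaussianSchwartz_apply, Complex.exp_add]
    push_cast
    rfl
  have hG0 : ∀ ξ, G 0 ξ = Real.exp (-(Real.pi * t) * ‖ξ‖ ^ 2) := by
    intro ξ; simp [e0]
  -- Writing out the Fourier integral of `f`, the phase for `y` combines with the Gaussian into `G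
  -- y`. After Fubini, each fixed `y` falls under `norm_integral_mul_gaussian_le`.
  have e1 : ∀ ξ, h ξ * (starRingEnd ℂ) (𝓕 f ξ) * Real.exp (-(Real.pi * t) * ‖ξ‖ ^ 2) =
      ∫ y, G y ξ * h ξ * (starRingEnd ℂ) (f y) := by
    intro ξ
    rw [Real.fourier_eq', ← integral_conj, mul_right_comm, ← integral_const_mul]
    refine integral_congr_ae (Filter.Eventually.of_forall fun y => ?_)
    simp only [e0, smul_eq_mul, map_mul, ← Complex.exp_conj, Complex.conj_ofReal, Complex.conj_I]
    push_cast
    ring_nf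
  have hint : Integrable (Function.uncurry fun ξ y => G y ξ * h ξ * (starRingEnd ℂ) (f y))
      ((volume : Measure E3).prod volume) := by
    have h1 : Integrable (fun p : E3 × E3 => (G 0 p.1 * h p.1) * (starRingEnd ℂ) (f p.2))
        ((volume : Measure E3).prod volume) :=
      (hh (G 0)).1.mul_prod ((Complex.conjLIE.toContinuousLinearEquiv.integrable_comp_iff).2 hf)
    refine (h1.bdd_mul (c := 1) (f := fun p : E3 × E3 =>
      Complex.exp (2 * Real.pi * Complex.I * ⟪p.2, p.1⟫_ℝ))
      (Continuous.aestronglyMeasurable (by fun_prop))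
      (Filter.Eventually.of_forall fun p => ?_)).congr (Filter.Eventually.of_forall fun p => ?_)
    · rw [Complex.norm_exp]; simp
    · simp only [Function.uncurry, hG0, e0]
      ring
  simp_rw [e1]
  rw [integral_integral_swap hint]
  refine (norm_integral_le_of_norm_le (g := fun y => M * ‖f y‖) (hf.norm.const_mul M)
    (Filter.Eventually.of_forall fun y => ?_)).trans (integral_const_mul _ _).le
  rw [integral_mul_const, norm_mul, RCLike.norm_conj]
  gcongr
  exact norm_integral_mul_gaussian_le hρ hM hh ht y

/-! ### The Coulomb inner product in Fourier variables -/

theorem RepresentedBy.aestronglyMeasurable {T : 𝓢'(E3, ℂ)} {f : E3 → ℂ} (h : RepresentedBy T f) :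
    AEStronglyMeasurable f volume := by
  set φ : 𝓢(E3, ℂ) := gaussianSchwartz one_pos 0
  have hne : ∀ x, φ x ≠ 0 := fun x => Complex.exp_ne_zero _
  have hc : Continuous fun x => (φ x)⁻¹ := φ.continuous.inv₀ hne
  refine (hc.aestronglyMeasurable.mul (h φ).1.1).congr (Filter.Eventually.of_forall fun x => ?_)
  simp [hne x]

/-- The Fourier transform of an element of the Coulomb space, in Mathlib's normalization. -/
def coulombFourier (T : 𝓢'(E3, ℂ)) (ξ : E3) : ℂ :=
  ((2 * Real.pi) ^ (3 / 2 : ℝ) : ℝ) * coulombHat T ((2 * Real.pi) • ξ)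

theorem representedBy_coulombFourier {T : 𝓢'(E3, ℂ)} (hT : T ∈ coulombSpace) :
    RepresentedBy (𝓕 T) (coulombFourier T) := by
  have h : HasFourierTransform T (coulombHat T) := by
    rw [coulombHat, dif_pos hT]; exact hT.choose_spec.1
  exact h

/-- The two normalizing factors contribute `(2π)³` and `‖2πξ‖²` contributes `(2π)²`. At `ξ = 0` both
sides are zero by the convention for division. -/
theorem coulombFourier_mul_conj_div (T₁ T₂ : 𝓢'(E3, ℂ)) (ξ : E3) :
    coulombFourier T₁ ξ * (starRingEnd ℂ) (coulombFourier T₂ ξ) / (‖ξ‖ ^ 2 : ℝ) =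
      ((2 * Real.pi) ^ 5 : ℝ) * (coulombHat T₁ ((2 * Real.pi) • ξ) *
        (starRingEnd ℂ) (coulombHat T₂ ((2 * Real.pi) • ξ)) /
          (‖(2 * Real.pi) • ξ‖ ^ 2 : ℝ)) := by
  have h1 : (2 * Real.pi) ^ (3 / 2 : ℝ) * (2 * Real.pi) ^ (3 / 2 : ℝ) = (2 * Real.pi) ^ 3 := by
    rw [← Real.rpow_add (by positivity), ← Real.rpow_natCast]; norm_num
  have h2 : ‖(2 * Real.pi) • ξ‖ = 2 * Real.pi * ‖ξ‖ := by
    rw [norm_smul, Real.norm_of_nonneg (by positivity)]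
  have h1' := congrArg (fun r : ℝ => (r : ℂ)) h1
  have hp : (Real.pi : ℂ) ≠ 0 := by exact_mod_cast Real.pi_ne_zero
  simp only [coulombFourier, map_mul, Complex.conj_ofReal, h2]
  rcases eq_or_ne ξ 0 with rfl | hξ
  · simp
  have hx : ((‖ξ‖ : ℝ) : ℂ) ≠ 0 := by exact_mod_cast norm_ne_zero_iff.2 hξ
  push_cast at h1' ⊢
  rw [mul_mul_mul_comm, h1']
  field_simp

/-- Substituting `k = 2πξ` gives the constant `4π (2π)³ / (2π)⁵ = 1/π`. -/
theorem coulombInner_eq_fourier (T₁ T₂ : 𝓢'(E3, ℂ)) : coulombInner T₁ T₂ =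
    (Real.pi : ℂ)⁻¹ * ∫ ξ, coulombFourier T₁ ξ * (starRingEnd ℂ) (coulombFourier T₂ ξ) /
      (‖ξ‖ ^ 2 : ℝ) := by
  simp_rw [coulombFourier_mul_conj_div]
  rw [integral_const_mul, Measure.integral_comp_smul volume (fun k => coulombHat T₁ k *
        (starRingEnd ℂ) (coulombHat T₂ k) / (‖k‖ ^ 2 : ℝ)), coulombInner,
    finrank_euclideanSpace, Fintype.card_fin, abs_of_pos (by positivity), Complex.real_smul]
  have hp : (Real.pi : ℂ) ≠ 0 := by exact_mod_cast Real.pi_ne_zero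
  push_cast
  field_simp
  ring

theorem integrable_norm_coulombFourier_sq_div {T : 𝓢'(E3, ℂ)} (hT : T ∈ coulombSpace) :
    Integrable fun ξ => ‖coulombFourier T ξ‖ ^ 2 / ‖ξ‖ ^ 2 := by
  have h : Integrable fun k => ‖coulombHat T k‖ ^ 2 / ‖k‖ ^ 2 := by
    rw [coulombHat, dif_pos hT]; exact hT.choose_spec.2
  refine ((h.comp_smul (R := 2 * Real.pi) (by positivity)).const_mul
    ((2 * Real.pi) ^ 5)).congr (Filter.Eventually.of_forall fun ξ => ?_)
  have := congrArg norm (coulombFourier_mul_conj_div T T ξ)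
  simpa [← pow_two, abs_of_pos Real.pi_pos] using this.symm

theorem integrable_coulombFourier_mul_conj_div {T₁ T₂ : 𝓢'(E3, ℂ)} (h₁ : T₁ ∈ coulombSpace)
    (h₂ : T₂ ∈ coulombSpace) : Integrable fun ξ => coulombFourier T₁ ξ *
      (starRingEnd ℂ) (coulombFourier T₂ ξ) / (‖ξ‖ ^ 2 : ℝ) := by
  refine ((integrable_norm_coulombFourier_sq_div h₁).add
    (integrable_norm_coulombFourier_sq_div h₂)).mono' ?_ (Filter.Eventually.of_forall fun ξ => ?_)
  · refine ((representedBy_coulombFourier h₁).aestronglyMeasurable.mul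
      (Complex.continuous_conj.comp_aestronglyMeasurable
        (representedBy_coulombFourier h₂).aestronglyMeasurable)).div₀ ?_
    exact Continuous.aestronglyMeasurable (by fun_prop)
  · rw [norm_div, norm_mul, RCLike.norm_conj, Complex.norm_real, norm_pow, norm_norm,
      Pi.add_apply, ← add_div]
    gcongr
    nlinarith [sq_nonneg (‖coulombFourier T₁ ξ‖ - ‖coulombFourier T₂ ξ‖),
      sq_nonneg ‖coulombFourier T₁ ξ‖, sq_nonneg ‖coulombFourier T₂ ξ‖]

theorem re_coulombInner_self (T : 𝓢'(E3, ℂ)) :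
    (coulombInner T T).re = Real.pi⁻¹ * ∫ ξ, ‖coulombFourier T ξ‖ ^ 2 / ‖ξ‖ ^ 2 := by
  have h : ∀ ξ, coulombFourier T ξ * (starRingEnd ℂ) (coulombFourier T ξ) / (‖ξ‖ ^ 2 : ℝ) =
      ((‖coulombFourier T ξ‖ ^ 2 / ‖ξ‖ ^ 2 : ℝ) : ℂ) := by
    intro ξ
    rw [Complex.mul_conj, Complex.normSq_eq_norm_sq]
    push_cast
    rfl
  rw [coulombInner_eq_fourier]
  simp_rw [h]
  rw [integral_complex_ofReal, ← Complex.ofReal_inv, ← Complex.ofReal_mul, Complex.ofReal_re]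

/-- The Coulomb interaction of a bounded density with an integrable one: the long-distance part
is controlled by the Coulomb energy of the first, the short-distance part by its supremum. -/
theorem re_coulombInner_le {T₁ T₂ : 𝓢'(E3, ℂ)} {ρ f : E3 → ℂ} {M s : ℝ} (h₁ : T₁ ∈ coulombSpace)
    (h₂ : T₂ ∈ coulombSpace) (hρ : RepresentedBy T₁ ρ) (hM : ∀ x, ‖ρ x‖ ≤ M)
    (hf : Integrable f) (hT₂ : RepresentedBy T₂ f) (hs : 0 < s) :
    (coulombInner T₁ T₂).re ≤ 1 / 2 * (coulombInner T₁ T₁).re +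
      (∫ y, ‖f y‖) ^ 2 / √(2 * s) + s * (M * ∫ y, ‖f y‖) := by
  set Z := ∫ y, ‖f y‖ with hZ
  set u := coulombFourier T₁
  set v := coulombFourier T₂
  have hu : RepresentedBy (𝓕 T₁) u := representedBy_coulombFourier h₁
  -- `coulombHat` is an arbitrary choice; uniqueness identifies it almost everywhere with the
  -- Fourier integral, which is bounded by the L¹-norm `Z`.
  have hvf : v =ᵐ[volume] 𝓕 f := by
    obtain ⟨T, hT, hT'⟩ := exists_representedBy_of_integrable hf
    rw [← hT₂.eq hT] at hT'
    exact (representedBy_coulombFourier h₂).ae_eq hT'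
  have hvZ : ∀ᵐ ξ, ‖v ξ‖ ≤ Z := by
    filter_upwards [hvf] with ξ hξ
    rw [hξ]
    exact VectorFourier.norm_fourierIntegral_le_integral_norm _ _ _ f ξ
  set e : E3 → ℝ := fun ξ => Real.exp (-(Real.pi * s) * ‖ξ‖ ^ 2) with he
  have he1 : ∀ ξ, e ξ ≤ 1 := by
    intro ξ
    rw [he, Real.exp_le_one_iff]
    have : 0 ≤ Real.pi * s * ‖ξ‖ ^ 2 := by positivity
    linarith
  have he0 : ∀ ξ, 0 < e ξ := fun ξ => Real.exp_pos _
  have hec : Continuous e := by fun_prop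
  set a : E3 → ℂ := fun ξ => u ξ * (starRingEnd ℂ) (v ξ) / (‖ξ‖ ^ 2 : ℝ) with ha
  have hai : Integrable a := integrable_coulombFourier_mul_conj_div h₁ h₂
  have hae : Integrable fun ξ => a ξ * (e ξ : ℂ) :=
    hai.mul_bdd (c := 1) (Complex.continuous_ofReal.comp hec).aestronglyMeasurable
      (Filter.Eventually.of_forall fun ξ => by
        rw [Complex.norm_real, Real.norm_of_nonneg (he0 ξ).le]; exact he1 ξ)
  have hsplit : ∫ ξ, a ξ = (∫ ξ, a ξ * (e ξ : ℂ)) + ∫ ξ, a ξ * ((1 - e ξ : ℝ) : ℂ) := by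
    rw [← integral_add hae]
    · refine integral_congr_ae (Filter.Eventually.of_forall fun ξ => ?_)
      push_cast; ring
    · refine (hai.sub hae).congr (Filter.Eventually.of_forall fun ξ => ?_)
      simp; ring
  have hshort : ‖∫ ξ, a ξ * ((1 - e ξ : ℝ) : ℂ)‖ ≤ Real.pi * s * (M * Z) := by
    refine norm_integral_mul_one_sub_gaussian_div_le hs hai fun t ht => ?_
    have h := norm_integral_mul_conj_fourier_mul_gaussian_le hρ hM hu hf ht
    refine le_trans (le_of_eq ?_) h
    congr 1
    refine integral_congr_ae ?_
    filter_upwards [hvf] with ξ hξ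
    rw [hξ]
  -- Pointwise `‖u‖ ‖v‖ e ≤ ‖u‖²/2 + Z² e²/2`, and `e²` is a Gaussian of parameter `2πs`, so its
  -- integral against `‖ξ‖⁻²` is explicit.
  have hlong : ‖∫ ξ, a ξ * (e ξ : ℂ)‖ ≤ 1 / 2 * (∫ ξ, ‖u ξ‖ ^ 2 / ‖ξ‖ ^ 2) +
      1 / 2 * Z ^ 2 * (2 * Real.pi * √(Real.pi / (2 * (Real.pi * s)))) := by
    have hui := integrable_norm_coulombFourier_sq_div h₁
    have hc : 0 < 2 * (Real.pi * s) := by positivity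
    rw [← integral_gaussian_div_norm_sq, ← integral_const_mul, ← integral_const_mul,
      ← integral_add (hui.const_mul _) ((integrable_gaussian_div_norm_sq hc).const_mul _)]
    refine norm_integral_le_of_norm_le ((hui.const_mul _).add
      ((integrable_gaussian_div_norm_sq hc).const_mul _)) ?_
    filter_upwards [hvZ] with ξ hξ
    have hee : Real.exp (-(2 * (Real.pi * s)) * ‖ξ‖ ^ 2) = e ξ ^ 2 := by
      rw [he, ← Real.exp_nat_mul]; congr 1; push_cast; ring
    rw [hee, norm_mul, norm_div, norm_mul, RCLike.norm_conj, Complex.norm_real, Complex.norm_real,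
      norm_pow, norm_norm, Real.norm_of_nonneg (he0 ξ).le, mul_div_assoc', mul_div_assoc',
      ← add_div, div_mul_eq_mul_div]
    gcongr
    have h3 : ‖v ξ‖ ^ 2 * e ξ ^ 2 ≤ Z ^ 2 * e ξ ^ 2 := by gcongr
    nlinarith [sq_nonneg (‖u ξ‖ - ‖v ξ‖ * e ξ)]
  have hsq : √(Real.pi / (2 * (Real.pi * s))) = 1 / √(2 * s) := by
    rw [show Real.pi / (2 * (Real.pi * s)) = 1 / (2 * s) by field_simp, Real.sqrt_div zero_le_one,
      Real.sqrt_one]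
  rw [hsq] at hlong
  have htot : (∫ ξ, a ξ).re ≤ 1 / 2 * (∫ ξ, ‖u ξ‖ ^ 2 / ‖ξ‖ ^ 2) +
      1 / 2 * Z ^ 2 * (2 * Real.pi * (1 / √(2 * s))) + Real.pi * s * (M * Z) := by
    refine (Complex.re_le_norm _).trans ?_
    rw [hsplit]
    exact (norm_add_le _ _).trans (add_le_add hlong hshort)
  rw [re_coulombInner_self, coulombInner_eq_fourier, ← Complex.ofReal_inv, Complex.re_ofReal_mul]
  calc _ ≤ Real.pi⁻¹ * (1 / 2 * (∫ ξ, ‖u ξ‖ ^ 2 / ‖ξ‖ ^ 2) +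
      1 / 2 * Z ^ 2 * (2 * Real.pi * (1 / √(2 * s))) + Real.pi * s * (M * Z)) := by gcongr
    _ = _ := by
      have := Real.pi_ne_zero
      simp only [show coulombFourier T₁ = u from rfl]
      field_simp

/-! ### Traces of products of positive operators -/

section Trace

variable {H : Type*} [NormedAddCommGroup H] [InnerProductSpace ℂ H] {ι : Type*}

theorem hasSum_norm_inner_sq (b : HilbertBasis ι ℂ H) (x : H) :
    HasSum (fun i => ‖⟪b i, x⟫_ℂ‖ ^ 2) (‖x‖ ^ 2) := by
  have h := (b.hasSum_inner_mul_inner x x).mapL Complex.reCLM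
  have e : (fun i => ‖⟪b i, x⟫_ℂ‖ ^ 2) = fun i => Complex.reCLM (⟪x, b i⟫_ℂ * ⟪b i, x⟫_ℂ) := by
    funext i
    rw [← inner_conj_symm (b i) x, Complex.mul_conj']
    simp [← Complex.ofReal_pow, norm_inner_symm]
  rw [e]
  convert h
  rw [inner_self_eq_norm_sq_to_K]
  simp [← Complex.ofReal_pow]

/-- The matrix elements of a Hilbert–Schmidt operator are square summable. -/
theorem summable_norm_inner_sq (b : HilbertBasis ι ℂ H) {X : H →L[ℂ] H}
    (hX : Summable fun i => ‖X (b i)‖ ^ 2) :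
    Summable fun p : ι × ι => ‖⟪b p.2, X (b p.1)⟫_ℂ‖ ^ 2 := by
  rw [summable_prod_of_nonneg (fun p => by positivity)]
  refine ⟨fun i => (hasSum_norm_inner_sq b (X (b i))).summable, ?_⟩
  simpa only [(hasSum_norm_inner_sq b (X (b _))).tsum_eq] using hX

variable [CompleteSpace H]

/-- By Parseval both series are sums of the same squared matrix elements, by rows or by columns. -/
theorem summable_norm_adjoint_sq (b : HilbertBasis ι ℂ H) {X : H →L[ℂ] H}
    (hX : Summable fun i => ‖X (b i)‖ ^ 2) :
    Summable fun i => ‖ContinuousLinearMap.adjoint X (b i)‖ ^ 2 := by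
  have h := (summable_norm_inner_sq b hX).prod_symm.prod
  refine h.congr fun i => ?_
  rw [← (hasSum_norm_inner_sq b (ContinuousLinearMap.adjoint X (b i))).tsum_eq]
  refine tsum_congr fun j => ?_
  simp only [Prod.swap_prod_mk]
  rw [ContinuousLinearMap.adjoint_inner_right, norm_inner_symm]

/-- The Hilbert–Schmidt inner product is invariant under adjoints. -/
theorem hasSum_inner_adjoint (b : HilbertBasis ι ℂ H) {X Y : H →L[ℂ] H}
    (hX : Summable fun i => ‖X (b i)‖ ^ 2) (hY : Summable fun i => ‖Y (b i)‖ ^ 2) :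
    HasSum (fun i => ⟪X (b i), Y (b i)⟫_ℂ)
      (∑' j, ⟪ContinuousLinearMap.adjoint Y (b j), ContinuousLinearMap.adjoint X (b j)⟫_ℂ) := by
  -- Absolute convergence of the double series permits summing it in either order.
  have hs : Summable fun p : ι × ι => ⟪X (b p.1), b p.2⟫_ℂ * ⟪b p.2, Y (b p.1)⟫_ℂ := by
    refine Summable.of_norm_bounded ((summable_norm_inner_sq b hX).add
      (summable_norm_inner_sq b hY)) fun p => ?_
    rw [norm_mul, norm_inner_symm]
    nlinarith [sq_nonneg (‖⟪b p.2, X (b p.1)⟫_ℂ‖ - ‖⟪b p.2, Y (b p.1)⟫_ℂ‖),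
      sq_nonneg ‖⟪b p.2, X (b p.1)⟫_ℂ‖, sq_nonneg ‖⟪b p.2, Y (b p.1)⟫_ℂ‖]
  have h1 : ∀ i, HasSum (fun j => ⟪X (b i), b j⟫_ℂ * ⟪b j, Y (b i)⟫_ℂ) ⟪X (b i), Y (b i)⟫_ℂ :=
    fun i => b.hasSum_inner_mul_inner _ _
  have h2 : ∀ j, HasSum (fun i => ⟪X (b i), b j⟫_ℂ * ⟪b j, Y (b i)⟫_ℂ)
      ⟪ContinuousLinearMap.adjoint Y (b j), ContinuousLinearMap.adjoint X (b j)⟫_ℂ := by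
    intro j
    refine (b.hasSum_inner_mul_inner _ _).congr_fun ?_
    intro i
    rw [ContinuousLinearMap.adjoint_inner_left, ContinuousLinearMap.adjoint_inner_right, mul_comm]
  have h3 := hs.hasSum.prod_fiberwise h1
  have h4 := hs.prod_symm.hasSum.prod_fiberwise h2
  have h5 : ∑' p : ι × ι, ⟪X (b p.swap.1), b p.swap.2⟫_ℂ * ⟪b p.swap.2, Y (b p.swap.1)⟫_ℂ =
      ∑' p : ι × ι, ⟪X (b p.1), b p.2⟫_ℂ * ⟪b p.2, Y (b p.1)⟫_ℂ :=
    (Equiv.prodComm ι ι).tsum_eq fun p : ι × ι => ⟪X (b p.1), b p.2⟫_ℂ * ⟪b p.2, Y (b p.1)⟫_ℂ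
  rw [h4.tsum_eq, h5]
  exact h3

/-- The trace of the product of a positive operator and a positive trace-class operator is
non-negative. -/
theorem summable_trace_mul_nonneg {A B : H →L[ℂ] H} (hA : 0 ≤ A) (hB : 0 ≤ B)
    (hBs : IsSchatten 1 B) :
    Summable (fun i => ⟪basis H i, (A * B) (basis H i)⟫_ℂ) ∧ 0 ≤ (opTrace (A * B)).re := by
  set R := CFC.sqrt B with hR
  have hR0 : 0 ≤ R := CFC.sqrt_nonneg B
  have hRsa : ContinuousLinearMap.adjoint R = R := (IsSelfAdjoint.of_nonneg hR0).star_eq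
  have hAsa : ContinuousLinearMap.adjoint A = A := (IsSelfAdjoint.of_nonneg hA).star_eq
  have hRR : R * R = B := CFC.sqrt_mul_sqrt_self B hB
  -- The trace of `B` is the squared Hilbert–Schmidt norm of its square root.
  have hRs : Summable fun i => ‖R (basis H i)‖ ^ 2 := by
    refine hBs.congr fun i => ?_
    rw [CFC.abs_of_nonneg B hB, pow_one, ← hRR, mul_apply_eq_comp,
      ← ContinuousLinearMap.adjoint_inner_left, hRsa, inner_self_eq_norm_sq]
  have hARs : Summable fun i => ‖(A * R) (basis H i)‖ ^ 2 := by
    refine Summable.of_nonneg_of_le (fun i => by positivity) (fun i => ?_)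
      (hRs.mul_left (‖A‖ ^ 2))
    rw [← mul_pow]
    gcongr
    exact A.le_opNorm _
  have hadj : ContinuousLinearMap.adjoint (A * R) = R * A := by
    have := star_mul A R
    rw [ContinuousLinearMap.star_eq_adjoint, ContinuousLinearMap.star_eq_adjoint,
      ContinuousLinearMap.star_eq_adjoint, hRsa, hAsa] at this
    exact this
  have hadj' : ContinuousLinearMap.adjoint (R * A) = A * R := by
    rw [← hadj, ContinuousLinearMap.adjoint_adjoint]
  have hRAs : Summable fun i => ‖(R * A) (basis H i)‖ ^ 2 := by
    rw [← hadj]; exact summable_norm_adjoint_sq _ hARs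
  -- Cyclicity of the trace in disguise: with `X = R A` and `Y = R` it turns `tr (A R R)` into the
  -- sum of `⟪R e, A R e⟫`, whose terms have non-negative real part.
  have h := hasSum_inner_adjoint (basis H) hRAs hRs
  have e : ∀ i, ⟪(R * A) (basis H i), R (basis H i)⟫_ℂ = ⟪basis H i, (A * B) (basis H i)⟫_ℂ := by
    intro i
    rw [← ContinuousLinearMap.adjoint_inner_right, hadj', ← hRR]
    rfl
  simp_rw [e] at h
  refine ⟨h.summable, ?_⟩
  rw [opTrace, h.tsum_eq, hRsa, hadj']
  have hs := (hasSum_inner_adjoint (basis H) hRs hARs).summable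
  rw [Complex.re_tsum hs]
  refine tsum_nonneg fun j => ?_
  have := ((ContinuousLinearMap.nonneg_iff_isPositive A).1 hA).re_inner_nonneg_right (R (basis H j))
  exact this

/-! ### Spectral projections of operators with a spectral gap at zero -/

theorem isSelfAdjoint_spectralProjNeg (A : H →L[ℂ] H) : IsSelfAdjoint (spectralProjNeg A) :=
  cfc_predicate _ _

/-- The only jump is at the excluded point. Continuity on the spectrum matters because `cfc` returns
zero for discontinuous functions. -/
theorem continuousOn_indicator_neg {S : Set ℝ} (hS : (0 : ℝ) ∉ S) :
    ContinuousOn (fun x : ℝ => if x < 0 then (1 : ℝ) else 0) S := by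
  intro x hx
  refine ContinuousAt.continuousWithinAt ?_
  have hx0 : x ≠ 0 := fun h => hS (h ▸ hx)
  rcases lt_or_gt_of_ne hx0 with h | h
  · refine (continuousAt_const (y := (1 : ℝ))).congr ?_
    filter_upwards [Iio_mem_nhds h] with y hy
    rw [if_pos (Set.mem_Iio.1 hy)]
  · refine (continuousAt_const (y := (0 : ℝ))).congr ?_
    filter_upwards [Ioi_mem_nhds h] with y hy
    rw [if_neg (not_lt.2 (le_of_lt (Set.mem_Ioi.1 hy)))]

variable {A : H →L[ℂ] H}

theorem spectralProjNeg_mul_self (h0 : (0 : ℝ) ∉ spectrum ℝ A) :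
    spectralProjNeg A * spectralProjNeg A = spectralProjNeg A := by
  have hc := continuousOn_indicator_neg h0
  rw [spectralProjNeg, ← cfc_mul _ _ _ hc hc]
  congr 1
  funext x
  split_ifs <;> simp

theorem mul_spectralProjNeg (hA : IsSelfAdjoint A) (h0 : (0 : ℝ) ∉ spectrum ℝ A) :
    A * spectralProjNeg A =
      cfc (p := IsSelfAdjoint) (fun x : ℝ => x * if x < 0 then (1 : ℝ) else 0) A := by
  have hc := continuousOn_indicator_neg h0
  rw [cfc_mul (fun x : ℝ => x) _ A (continuousOn_id' _) hc, cfc_id' ℝ A hA]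
  rfl

theorem spectralProjNeg_mul_comm (hA : IsSelfAdjoint A) :
    spectralProjNeg A * A = A * spectralProjNeg A := by
  have h := (cfc_commute_cfc (p := IsSelfAdjoint) (fun x : ℝ => if x < 0 then (1 : ℝ) else 0)
    (fun x : ℝ => x) A).eq
  rwa [cfc_id' ℝ A hA] at h

/-- This operator is the negative part of `A`; the next lemma treats the positive part. -/
theorem neg_mul_spectralProjNeg_nonneg (hA : IsSelfAdjoint A) (h0 : (0 : ℝ) ∉ spectrum ℝ A) :
    0 ≤ -A * spectralProjNeg A := by
  rw [neg_mul, mul_spectralProjNeg hA h0, ← cfc_neg]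
  refine cfc_nonneg fun x _ => ?_
  split_ifs with h
  · simpa using h.le
  · simp

theorem mul_one_sub_spectralProjNeg_nonneg (hA : IsSelfAdjoint A) (h0 : (0 : ℝ) ∉ spectrum ℝ A) :
    0 ≤ A * (1 - spectralProjNeg A) := by
  have hc := continuousOn_indicator_neg h0
  have h : A * (1 - spectralProjNeg A) = cfc (p := IsSelfAdjoint)
      (fun x : ℝ => x - x * if x < 0 then (1 : ℝ) else 0) A := by
    rw [cfc_sub (fun x : ℝ => x) (fun x : ℝ => x * if x < 0 then (1 : ℝ) else 0) A
      (continuousOn_id' _) ((continuousOn_id' _).mul hc),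
      cfc_id' ℝ A hA, ← mul_spectralProjNeg hA h0, mul_sub, mul_one]
  rw [h]
  refine cfc_nonneg fun x _ => ?_
  split_ifs with h
  · simp
  · simpa using h

/-- If `-P ≤ Q ≤ 1 - P` for the negative spectral projection `P` of `A`, then the diagonal blocks
of `A Q` have non-negative total trace. -/
theorem re_opTrace_diag_mul_nonneg {Q : H →L[ℂ] H} (hA : IsSelfAdjoint A)
    (h0 : (0 : ℝ) ∉ spectrum ℝ A) (hlo : -spectralProjNeg A ≤ Q) (hhi : Q ≤ 1 - spectralProjNeg A)
    (hpp : IsSchatten 1 ((1 - spectralProjNeg A) * Q * (1 - spectralProjNeg A)))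
    (hmm : IsSchatten 1 (spectralProjNeg A * Q * spectralProjNeg A)) :
    0 ≤ (opTrace ((1 - spectralProjNeg A) * (A * Q) * (1 - spectralProjNeg A) +
      spectralProjNeg A * (A * Q) * spectralProjNeg A)).re := by
  have hsa := isSelfAdjoint_spectralProjNeg A
  have hPP := spectralProjNeg_mul_self h0
  have hPA := spectralProjNeg_mul_comm hA
  have hp := mul_one_sub_spectralProjNeg_nonneg hA h0
  have hn := neg_mul_spectralProjNeg_nonneg hA h0
  set P := spectralProjNeg A
  have hsa' : IsSelfAdjoint (1 - P) := (IsSelfAdjoint.one _).sub hsa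
  -- Compressing `-P ≤ Q` to the range of `1 - P` annihilates the lower bound; `hB'` compresses the
  -- upper bound to the range of `P` likewise.
  have hB : 0 ≤ (1 - P) * Q * (1 - P) := by
    have h := hsa'.conjugate_le_conjugate hlo
    refine le_trans (le_of_eq ?_) h
    simp only [sub_mul, mul_sub, one_mul, mul_one, mul_neg, neg_mul, hPP]
    abel
  have hB' : 0 ≤ -(P * Q * P) := by
    have h := hsa.conjugate_le_conjugate hhi
    rw [neg_nonneg]
    refine h.trans (le_of_eq ?_)
    simp only [mul_sub, mul_one, hPP, sub_self, zero_mul]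
  have hmm' : IsSchatten 1 (-(P * Q * P)) := by
    unfold IsSchatten at hmm ⊢
    rwa [CFC.abs_neg]
  obtain ⟨s1, n1⟩ := summable_trace_mul_nonneg hp hB hpp
  obtain ⟨s2, n2⟩ := summable_trace_mul_nonneg hn hB' hmm'
  -- `A` commutes with the projections, so each block of `A Q` factors into two positive operators;
  -- in `e2` two signs cancel.
  have e1 : (1 - P) * (A * Q) * (1 - P) = A * (1 - P) * ((1 - P) * Q * (1 - P)) := by
    have hc : (1 - P) * A = A * (1 - P) := by
      rw [sub_mul, mul_sub, hPA, one_mul, mul_one]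
    have hi : (1 - P) * (1 - P) = 1 - P := by
      rw [sub_mul, one_mul, mul_sub, mul_one, hPP, sub_self, sub_zero]
    calc _ = (1 - P) * A * (Q * (1 - P)) := by simp only [mul_assoc]
      _ = A * ((1 - P) * (1 - P)) * (Q * (1 - P)) := by rw [hc, hi]
      _ = _ := by simp only [mul_assoc]
  have e2 : P * (A * Q) * P = -A * P * -(P * Q * P) := by
    calc _ = P * A * (Q * P) := by simp only [mul_assoc]
      _ = A * (P * P) * (Q * P) := by rw [hPA, hPP]
      _ = _ := by simp only [mul_assoc, neg_mul, mul_neg, neg_neg]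
  rw [e1, e2, opTrace]
  simp only [add_apply, inner_add_right]
  rw [s1.tsum_add s2, Complex.add_re]
  exact add_nonneg n1 n2

end Trace

theorem zero_notMem_spectrum_dirac (Λ : ℝ) : (0 : ℝ) ∉ spectrum ℝ (dirac Λ) := fun h => by
  have := one_le_abs_of_mem_spectrum_dirac Λ 0 h
  norm_num at this

/-- The kinetic energy of admissible states is non-negative. -/
theorem re_genTrace_dirac_mul_nonneg {Λ : ℝ} {Q : OneParticle Λ →L[ℂ] OneParticle Λ}
    (hQ : Q ∈ admissible Λ) : 0 ≤ (genTrace Λ (dirac Λ * Q)).re :=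
  re_opTrace_diag_mul_nonneg (isSelfAdjoint_dirac Λ) (zero_notMem_spectrum_dirac Λ)
    hQ.2.2.1 hQ.2.2.2 hQ.1.2.1 hQ.1.2.2

/-- A unitary involution anticommuting with `A` exchanges its two spectral subspaces. -/
theorem conj_spectralProjNeg {H : Type*} [NormedAddCommGroup H] [InnerProductSpace ℂ H]
    [CompleteSpace H] {A U : H →L[ℂ] H} (hA : IsSelfAdjoint A) (h0 : (0 : ℝ) ∉ spectrum ℝ A)
    (hU : IsSelfAdjoint U) (hUU : U * U = 1) (hUA : U * A * U = -A) :
    U * spectralProjNeg A * U = 1 - spectralProjNeg A := by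
  have hc := continuousOn_indicator_neg h0
  have hu : U ∈ unitary (H →L[ℂ] H) := by
    rw [Unitary.mem_iff, hU.star_eq]; exact ⟨hUU, hUU⟩
  -- Conjugation by `U` commutes with the functional calculus and sends `A` to `-A`. It thus
  -- replaces the indicator of `x < 0` by that of `x > 0`, which is the complement away from zero.
  set φ := Unitary.conjStarAlgAut ℝ (H →L[ℂ] H) ⟨U, hu⟩
  have hφ : ∀ X, φ X = U * X * U := fun X => by
    simp only [φ, Unitary.conjStarAlgAut_apply, hU.star_eq]
  have hφc : Continuous φ := by
    have : (φ : (H →L[ℂ] H) → (H →L[ℂ] H)) = fun X => U * X * U := funext hφ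
    rw [this]; fun_prop
  have h1 := StarAlgHomClass.map_cfc φ (fun x : ℝ => if x < 0 then (1 : ℝ) else 0) A hc hφc hA
    (by rw [hφ, hUA]; exact hA.neg)
  rw [hφ, hφ, hUA] at h1
  rw [spectralProjNeg, h1]
  have h2 : cfc (p := IsSelfAdjoint) (fun x : ℝ => if x < 0 then (1 : ℝ) else 0) (-A) =
      cfc (p := IsSelfAdjoint) (fun x : ℝ => if -x < 0 then (1 : ℝ) else 0) A := by
    refine (cfc_comp_neg (p := IsSelfAdjoint) (fun x : ℝ => if x < 0 then (1 : ℝ) else 0) A ?_ hA).symm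
    refine continuousOn_indicator_neg ?_
    rintro ⟨x, hx, hx0⟩
    exact h0 (by simpa [neg_eq_zero.1 hx0] using hx)
  have h3 : (1 : H →L[ℂ] H) = cfc (p := IsSelfAdjoint) (fun _ : ℝ => (1 : ℝ)) A :=
    (cfc_const_one ℝ A hA).symm
  rw [h2, h3, ← cfc_sub _ _ A continuousOn_const hc]
  refine cfc_congr fun x hx => ?_
  have hx0 : x ≠ 0 := fun h => h0 (h ▸ hx)
  rcases lt_or_gt_of_ne hx0 with h | h
  · simp [h, h.le]
  · simp [h, not_lt.2 h.le]

/-! ### The chirality operator -/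

/-- The matrix `σ₂ ⊗ 1`, which anticommutes with all four Dirac matrices. -/
def chiralityMatrix : Matrix (Fin 4) (Fin 4) ℂ :=
  (Matrix.fromBlocks 0 (-Complex.I • 1) (Complex.I • 1) 0).reindex
    (finSumFinEquiv (m := 2) (n := 2)) (finSumFinEquiv (m := 2) (n := 2))

theorem chiralityMatrix_eq : chiralityMatrix =
    !![0, 0, -Complex.I, 0; 0, 0, 0, -Complex.I; Complex.I, 0, 0, 0; 0, Complex.I, 0, 0] := by
  ext i j
  fin_cases i <;> fin_cases j <;>
    simp [chiralityMatrix, finSumFinEquiv, Fin.addCases, Matrix.fromBlocks]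

theorem chiralityMatrix_mul_self : chiralityMatrix * chiralityMatrix = 1 := by
  simp [chiralityMatrix, Matrix.submatrix_mul_equiv, Matrix.fromBlocks_multiply, smul_smul]

theorem chiralityMatrix_isHermitian : chiralityMatrix.IsHermitian := by
  rw [chiralityMatrix_eq]
  ext i j
  fin_cases i <;> fin_cases j <;> simp

theorem chiralityMatrix_conj_diracAlpha (i : Fin 3) :
    chiralityMatrix * diracAlpha i * chiralityMatrix = -diracAlpha i := by
  simp [chiralityMatrix, diracAlpha, Matrix.submatrix_mul_equiv, Matrix.fromBlocks_multiply,
    smul_smul]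
  exact (congrArg (fun M : Matrix (Fin 2 ⊕ Fin 2) (Fin 2 ⊕ Fin 2) ℂ =>
    M.submatrix (finSumFinEquiv (m := 2) (n := 2)).symm (finSumFinEquiv (m := 2) (n := 2)).symm)
    (by simp [Matrix.fromBlocks_neg])).trans (congrFun₂ (Matrix.submatrix_neg
      (Matrix.fromBlocks 0 (pauli i) (pauli i) 0)) _ _)

theorem chiralityMatrix_conj_diracBeta :
    chiralityMatrix * diracBeta * chiralityMatrix = -diracBeta := by
  simp [chiralityMatrix, diracBeta, Matrix.submatrix_mul_equiv, Matrix.fromBlocks_multiply,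
    smul_smul]
  exact (congrArg (fun M : Matrix (Fin 2 ⊕ Fin 2) (Fin 2 ⊕ Fin 2) ℂ =>
    M.submatrix (finSumFinEquiv (m := 2) (n := 2)).symm (finSumFinEquiv (m := 2) (n := 2)).symm)
    (by simp [Matrix.fromBlocks_neg])).trans (congrFun₂ (Matrix.submatrix_neg
      (Matrix.fromBlocks 1 0 0 (-1))) _ _)

theorem chiralityMatrix_conj_diracSymbol (p : E3) :
    chiralityMatrix * diracSymbol p * chiralityMatrix = -diracSymbol p := by
  simp only [diracSymbol, mul_add, add_mul, Finset.mul_sum, Finset.sum_mul, mul_smul_comm,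
    smul_mul_assoc, chiralityMatrix_conj_diracAlpha, chiralityMatrix_conj_diracBeta, smul_neg,
    Finset.sum_neg_distrib, neg_add]

/-- The action of `chiralityMatrix` on spinors. -/
def spinorChirality : Spinor →L[ℂ] Spinor :=
  Matrix.toEuclideanCLM (n := Fin 4) (𝕜 := ℂ) chiralityMatrix

theorem spinorChirality_mul_self : spinorChirality * spinorChirality = 1 := by
  rw [spinorChirality, ← map_mul, chiralityMatrix_mul_self, map_one]

theorem isSelfAdjoint_spinorChirality : IsSelfAdjoint spinorChirality :=
  chiralityMatrix_isHermitian.isSelfAdjoint.map (Matrix.toEuclideanCLM (n := Fin 4) (𝕜 := ℂ))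

theorem spinorChirality_conj_cutoffSymbol (Λ : ℝ) (ξ : E3) (v : Spinor) :
    spinorChirality (cutoffSymbol Λ ξ (spinorChirality v)) = -cutoffSymbol Λ ξ v := by
  by_cases h : ξ ∈ momentumBall Λ
  · simp only [cutoffSymbol, Set.indicator_of_mem h, spinorChirality]
    rw [← mul_apply_eq_comp, ← mul_apply_eq_comp, ← map_mul, ← map_mul,
      chiralityMatrix_conj_diracSymbol, map_neg, neg_apply]
  · simp [cutoffSymbol, h]

/-- The phases of the monomial matrix `chiralityMatrix`. -/
def chiralityPhase : Fin 4 → ℂ := ![Complex.I, Complex.I, -Complex.I, -Complex.I]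

theorem norm_chiralityPhase (a : Fin 4) : ‖chiralityPhase a‖ = 1 := by
  fin_cases a <;> simp [chiralityPhase]

/-- Addition in `Fin 4` is modulo 4, so `a ↦ a + 2` interchanges upper and lower spinor components.
-/
theorem spinorChirality_single (a : Fin 4) :
    spinorChirality (EuclideanSpace.single a (1 : ℂ)) =
      chiralityPhase a • EuclideanSpace.single (a + 2) (1 : ℂ) := by
  ext b
  rw [spinorChirality, Matrix.ofLp_toEuclideanCLM]
  fin_cases a <;> fin_cases b <;>
    simp [chiralityMatrix_eq, chiralityPhase]

/-- `spinorChirality`, acting pointwise in Fourier space. -/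
def chiralityL2 : L2Spinor →L[ℂ] L2Spinor :=
  (Lp.fourierTransformₗᵢ E3 Spinor).symm.toContinuousLinearEquiv.toContinuousLinearMap ∘L
    spinorChirality.compLpL 2 volume ∘L
      (Lp.fourierTransformₗᵢ E3 Spinor).toContinuousLinearEquiv.toContinuousLinearMap

theorem fourier_chiralityL2_ae (f : L2Spinor) :
    (𝓕 (chiralityL2 f) : L2Spinor) =ᵐ[volume] fun ξ => spinorChirality ((𝓕 f : L2Spinor) ξ) := by
  have h : (𝓕 (chiralityL2 f) : L2Spinor) = spinorChirality.compLpL 2 volume (𝓕 f : L2Spinor) :=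
    (Lp.fourierTransformₗᵢ E3 Spinor).apply_symm_apply _
  rw [h]
  exact ContinuousLinearMap.coeFn_compLpL _ _

/-- The chirality operator on the one-particle space. -/
def chirality (Λ : ℝ) : OneParticle Λ →L[ℂ] OneParticle Λ :=
  (chiralityL2 ∘L (oneParticleSpace Λ).subtypeL).codRestrict (oneParticleSpace Λ) (by
    intro f
    rw [mem_oneParticleSpace]
    filter_upwards [fourier_chiralityL2_ae (f : L2Spinor), mem_oneParticleSpace.1 f.2] with ξ h1 h2 h
    have h3 : (𝓕 ((chiralityL2 ∘L (oneParticleSpace Λ).subtypeL) f) : L2Spinor) ξ =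
      spinorChirality ((𝓕 (f : L2Spinor) : L2Spinor) ξ) := h1
    rw [h3, h2 h, map_zero])

theorem fourier_chirality_ae (Λ : ℝ) (f : OneParticle Λ) :
    (𝓕 (chirality Λ f : L2Spinor) : L2Spinor) =ᵐ[volume]
      fun ξ => spinorChirality ((𝓕 (f : L2Spinor) : L2Spinor) ξ) :=
  fourier_chiralityL2_ae _

theorem fourier_dirac_ae (Λ : ℝ) (f : OneParticle Λ) :
    (𝓕 (dirac Λ f : L2Spinor) : L2Spinor) =ᵐ[volume]
      fun ξ => cutoffSymbol Λ ξ ((𝓕 (f : L2Spinor) : L2Spinor) ξ) := by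
  have h : (𝓕 ((dirac Λ f : OneParticle Λ) : L2Spinor) : L2Spinor) =
      symbolMul Λ (𝓕 (f : L2Spinor)) := fourier_diracL2 Λ f
  rw [h]
  exact symbolMul_ae _ _

theorem OneParticle.ext_fourier {Λ : ℝ} {f g : OneParticle Λ}
    (h : (𝓕 (f : L2Spinor) : L2Spinor) =ᵐ[volume] (𝓕 (g : L2Spinor) : L2Spinor)) : f = g :=
  Subtype.ext ((Lp.fourierTransformₗᵢ E3 Spinor).injective (Lp.ext h))

theorem inner_eq_integral_fourier {Λ : ℝ} (f g : OneParticle Λ) :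
    ⟪f, g⟫_ℂ = ∫ ξ, ⟪(𝓕 (f : L2Spinor) : L2Spinor) ξ, (𝓕 (g : L2Spinor) : L2Spinor) ξ⟫_ℂ := by
  rw [Submodule.coe_inner, ← Lp.inner_fourier_eq, L2.inner_def]

theorem isSelfAdjoint_chirality (Λ : ℝ) : IsSelfAdjoint (chirality Λ) := by
  refine ContinuousLinearMap.isSelfAdjoint_iff_isSymmetric.2 fun f g => ?_
  change ⟪chirality Λ f, g⟫_ℂ = ⟪f, chirality Λ g⟫_ℂ
  rw [inner_eq_integral_fourier, inner_eq_integral_fourier]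
  refine integral_congr_ae ?_
  filter_upwards [fourier_chirality_ae Λ f, fourier_chirality_ae Λ g] with ξ h1 h2
  rw [h1, h2]
  exact isSelfAdjoint_spinorChirality.isSymmetric _ _

theorem chirality_mul_self (Λ : ℝ) : chirality Λ * chirality Λ = 1 := by
  ext1 f
  refine OneParticle.ext_fourier ?_
  filter_upwards [fourier_chirality_ae Λ f, fourier_chirality_ae Λ (chirality Λ f)] with ξ h1 h2
  rw [mul_apply_eq_comp, h2, h1, ← mul_apply_eq_comp, spinorChirality_mul_self]
  rfl

theorem chirality_conj_dirac (Λ : ℝ) : chirality Λ * dirac Λ * chirality Λ = -dirac Λ := by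
  ext1 f
  refine OneParticle.ext_fourier ?_
  have hneg : ((-dirac Λ) f : OneParticle Λ) = dirac Λ (-f) := by simp
  rw [hneg]
  have hn : (𝓕 ((-f : OneParticle Λ) : L2Spinor) : L2Spinor) = -(𝓕 (f : L2Spinor) : L2Spinor) :=
    map_neg (Lp.fourierTransformₗᵢ E3 Spinor) (f : L2Spinor)
  filter_upwards [fourier_chirality_ae Λ f, fourier_dirac_ae Λ (chirality Λ f),
    fourier_chirality_ae Λ (dirac Λ (chirality Λ f)), fourier_dirac_ae Λ (-f),
    Lp.coeFn_neg (𝓕 (f : L2Spinor) : L2Spinor)] with ξ h1 h2 h3 h4 h5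
  rw [h4, hn, h5, mul_apply_eq_comp, mul_apply_eq_comp, h3, h2, h1,
    spinorChirality_conj_cutoffSymbol, Pi.neg_apply, map_neg]

theorem fourier_evalVec_ae (Λ : ℝ) (x : E3) (a : Fin 4) :
    (𝓕 (evalVec Λ x a : L2Spinor) : L2Spinor) =ᵐ[volume] evalSymbol Λ x a := by
  have h : (𝓕 (evalVec Λ x a : L2Spinor) : L2Spinor) = (memLp_evalSymbol Λ x a).toLp :=
    FourierTransform.fourier_fourierInv_eq _
  rw [h]
  exact (memLp_evalSymbol Λ x a).coeFn_toLp

/-- The matrix is constant in `ξ`, so only the spinor index changes and the point `x` stays put. -/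
theorem chirality_evalVec (Λ : ℝ) (x : E3) (a : Fin 4) :
    chirality Λ (evalVec Λ x a) = chiralityPhase a • evalVec Λ x (a + 2) := by
  refine OneParticle.ext_fourier ?_
  have hs : (𝓕 ((chiralityPhase a • evalVec Λ x (a + 2) : OneParticle Λ) : L2Spinor) : L2Spinor) =
      chiralityPhase a • (𝓕 (evalVec Λ x (a + 2) : L2Spinor) : L2Spinor) :=
    map_smul (Lp.fourierTransformₗᵢ E3 Spinor) _ _
  rw [hs]
  filter_upwards [fourier_chirality_ae Λ (evalVec Λ x a), fourier_evalVec_ae Λ x a,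
    fourier_evalVec_ae Λ x (a + 2),
    Lp.coeFn_smul (chiralityPhase a) (𝓕 (evalVec Λ x (a + 2) : L2Spinor) : L2Spinor)] with ξ h1 h2 h3 h4
  rw [h1, h2, h4, Pi.smul_apply, h3]
  by_cases h : ξ ∈ momentumBall Λ
  · simp only [evalSymbol, Set.indicator_of_mem h, map_smul, spinorChirality_single]
    rw [smul_comm]
  · simp [evalSymbol, h]

/-! ### The pointwise bound on the density -/

theorem density_eq_sum (Λ : ℝ) (Q : OneParticle Λ →L[ℂ] OneParticle Λ) (x : E3) :
    density Λ Q x = ∑ a, ⟪evalVec Λ x a, Q (evalVec Λ x a)⟫_ℂ := rfl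

theorem inner_smul_smul_of_norm_eq_one {H : Type*} [NormedAddCommGroup H] [InnerProductSpace ℂ H]
    {c : ℂ} (hc : ‖c‖ = 1) (u v : H) : ⟪c • u, c • v⟫_ℂ = ⟪u, v⟫_ℂ := by
  rw [inner_smul_left, inner_smul_right, ← mul_assoc, Complex.conj_mul', hc]
  simp

/-- Chirality permutes the four vectors `evalVec Λ x a` up to phases of modulus one, which cancel in
diagonal matrix elements. -/
theorem density_chirality_conj (Λ : ℝ) (Q : OneParticle Λ →L[ℂ] OneParticle Λ) (x : E3) :
    density Λ (chirality Λ * Q * chirality Λ) x = density Λ Q x := by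
  rw [density_eq_sum, density_eq_sum]
  conv_rhs => rw [← Equiv.sum_comp (Equiv.addRight (2 : Fin 4))]
  refine Finset.sum_congr rfl fun a _ => ?_
  have h := ContinuousLinearMap.isSelfAdjoint_iff_isSymmetric.1 (isSelfAdjoint_chirality Λ)
    (evalVec Λ x a) (Q (chirality Λ (evalVec Λ x a)))
  rw [mul_apply_eq_comp, mul_apply_eq_comp]
  refine h.symm.trans ?_
  change ⟪chirality Λ (evalVec Λ x a), _⟫_ℂ = _
  rw [chirality_evalVec, map_smul]
  exact inner_smul_smul_of_norm_eq_one (H := OneParticle Λ) (norm_chiralityPhase a)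
    (evalVec Λ x (a + 2)) (Q (evalVec Λ x (a + 2)))

theorem volume_real_momentumBall {Λ : ℝ} (hΛ : 0 ≤ Λ) :
    volume.real (momentumBall Λ) = Λ ^ 3 / (6 * Real.pi ^ 2) := by
  have h : momentumBall Λ = Metric.closedBall 0 (Λ / (2 * Real.pi)) := by
    ext ξ
    rw [mem_closedBall_zero_iff, le_div_iff₀ (by positivity), mul_comm]
    rfl
  rw [h, Measure.real, EuclideanSpace.volume_closedBall_fin_three, ENNReal.toReal_mul,
    ENNReal.toReal_pow, ENNReal.toReal_ofReal (by positivity), ENNReal.toReal_ofReal (by positivity)]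
  field_simp
  ring

theorem inner_evalVec_self (Λ : ℝ) (x : E3) (a : Fin 4) :
    ⟪evalVec Λ x a, evalVec Λ x a⟫_ℂ = volume.real (momentumBall Λ) := by
  rw [inner_evalVec]
  have h : ∀ᵐ ξ ∂volume.restrict (momentumBall Λ),
      Complex.exp ((2 * Real.pi * ⟪x, ξ⟫_ℝ : ℝ) * Complex.I) *
        (𝓕 (evalVec Λ x a : L2Spinor) : L2Spinor) ξ a = 1 := by
    rw [ae_restrict_iff' (isClosed_momentumBall Λ).measurableSet]
    filter_upwards [fourier_evalVec_ae Λ x a] with ξ h1 h2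
    rw [h1, evalSymbol, Set.indicator_of_mem h2]
    simp [← Complex.exp_add]
  rw [integral_congr_ae h]
  simp

/-- `P⁰₋` and `1 - P⁰₋` are conjugate under chirality and so have equal densities. Their sum is the
density of the identity, four times the volume of the momentum ball. -/
theorem density_projNeg {Λ : ℝ} (hΛ : 0 ≤ Λ) (x : E3) :
    density Λ (projNeg Λ) x = (Λ ^ 3 / (3 * Real.pi ^ 2) : ℝ) := by
  have h : chirality Λ * projNeg Λ * chirality Λ = 1 - projNeg Λ :=
    conj_spectralProjNeg (isSelfAdjoint_dirac Λ) (zero_notMem_spectrum_dirac Λ)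
      (isSelfAdjoint_chirality Λ) (chirality_mul_self Λ) (chirality_conj_dirac Λ)
  have h1 := density_chirality_conj Λ (projNeg Λ) x
  rw [h, density_eq_sum] at h1
  simp only [sub_apply, inner_sub_right, Finset.sum_sub_distrib, one_apply_eq_self,
    inner_evalVec_self] at h1
  rw [← density_eq_sum, volume_real_momentumBall hΛ] at h1
  have h2 : density Λ (projNeg Λ) x = 2 * ((Λ ^ 3 / (6 * Real.pi ^ 2) : ℝ) : ℂ) := by
    simp only [Finset.sum_const, Finset.card_univ, Fintype.card_fin, nsmul_eq_mul] at h1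
    push_cast at h1 ⊢
    linear_combination (-1 / 2 : ℂ) * h1
  rw [h2]
  push_cast
  ring

theorem re_density_mono {Λ : ℝ} {Q R : OneParticle Λ →L[ℂ] OneParticle Λ} (h : Q ≤ R) (x : E3) :
    (density Λ Q x).re ≤ (density Λ R x).re := by
  rw [density_eq_sum, density_eq_sum, Complex.re_sum, Complex.re_sum]
  refine Finset.sum_le_sum fun a _ => ?_
  have h1 := ((ContinuousLinearMap.le_def Q R).1 h).re_inner_nonneg_right (evalVec Λ x a)
  rw [sub_apply, inner_sub_right, map_sub] at h1
  exact sub_nonneg.1 h1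

theorem im_density_of_isSelfAdjoint {Λ : ℝ} {Q : OneParticle Λ →L[ℂ] OneParticle Λ}
    (h : IsSelfAdjoint Q) (x : E3) : (density Λ Q x).im = 0 := by
  rw [← Complex.conj_eq_iff_im, density_eq_sum, map_sum]
  refine Finset.sum_congr rfl fun a _ => ?_
  refine (inner_conj_symm (𝕜 := ℂ) (Q (evalVec Λ x a)) (evalVec Λ x a)).trans ?_
  exact ContinuousLinearMap.isSelfAdjoint_iff_isSymmetric.1 h _ _

/-- The density is real and monotone in `Q`, and the two ends of the operator interval have opposite
constant densities. -/
theorem norm_density_le {Λ : ℝ} (hΛ : 0 ≤ Λ) {Q : OneParticle Λ →L[ℂ] OneParticle Λ}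
    (hQ : Q ∈ admissible Λ) (x : E3) : ‖density Λ Q x‖ ≤ Λ ^ 3 / (3 * Real.pi ^ 2) := by
  obtain ⟨-, hsa, hlo, hhi⟩ := hQ
  have h1 := re_density_mono hlo x
  have h2 := re_density_mono hhi x
  have hneg : density Λ (-projNeg Λ) x = -density Λ (projNeg Λ) x := by
    simp [density_eq_sum]
  have hpos : density Λ (1 - projNeg Λ) x = density Λ (projNeg Λ) x := by
    have h : chirality Λ * projNeg Λ * chirality Λ = 1 - projNeg Λ :=
      conj_spectralProjNeg (isSelfAdjoint_dirac Λ) (zero_notMem_spectrum_dirac Λ)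
        (isSelfAdjoint_chirality Λ) (chirality_mul_self Λ) (chirality_conj_dirac Λ)
    rw [← h, density_chirality_conj]
  rw [hneg, density_projNeg hΛ, Complex.neg_re, Complex.ofReal_re] at h1
  rw [hpos, density_projNeg hΛ, Complex.ofReal_re] at h2
  rw [← Complex.re_add_im (density Λ Q x), im_density_of_isSelfAdjoint hsa]
  simp only [Complex.ofReal_zero, zero_mul, add_zero, Complex.norm_real, Real.norm_eq_abs]
  exact abs_le.2 ⟨h1, h2⟩

/-! ### Optimization and the energy bound -/

theorem RepresentedBy.zero : RepresentedBy 0 0 := fun φ => by simp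

theorem RepresentedBy.const_smul {T : 𝓢'(E3, ℂ)} {f : E3 → ℂ} (h : RepresentedBy T f) (c : ℂ) :
    RepresentedBy (c • T) fun x => c * f x := by
  intro φ
  have e : ∀ x, φ x * (c * f x) = c * (φ x * f x) := fun x => by ring
  simp_rw [e]
  refine ⟨(h φ).1.const_mul c, ?_⟩
  rw [integral_const_mul, ← (h φ).2]
  rfl

theorem smul_mem_coulombSpace {T : 𝓢'(E3, ℂ)} (hT : T ∈ coulombSpace) (c : ℂ) :
    c • T ∈ coulombSpace := by
  obtain ⟨g, hg, hi⟩ := hT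
  refine ⟨fun k => c * g k, ?_, ?_⟩
  · have h := hg.const_smul c
    rw [← FourierTransform.fourier_smul] at h
    simpa only [HasFourierTransform, mul_left_comm] using h
  · simpa only [norm_mul, mul_pow, mul_div_assoc] using hi.const_mul (‖c‖ ^ 2)

theorem coulombHat_of_notMem {T : 𝓢'(E3, ℂ)} (hT : T ∉ coulombSpace) : coulombHat T = 0 :=
  dif_neg hT

/-- If `f` represents no distribution, `toDistribution f` is zero and the zero function serves;
hence no regularity of the density is needed. -/
theorem exists_representedBy_toDistribution {f : E3 → ℂ} {M : ℝ} (hM : ∀ x, ‖f x‖ ≤ M) :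
    ∃ ρ, RepresentedBy (toDistribution f) ρ ∧ ∀ x, ‖ρ x‖ ≤ M := by
  by_cases h : ∃ T : 𝓢'(E3, ℂ), RepresentedBy T f
  · obtain ⟨T, hT⟩ := h
    exact ⟨f, hT.toDistribution_eq.symm ▸ hT, hM⟩
  · refine ⟨0, ?_, fun x => by simpa using (norm_nonneg _).trans (hM 0)⟩
    rw [toDistribution, dif_neg h]
    exact RepresentedBy.zero

theorem re_coulombInner_self_nonneg (T : 𝓢'(E3, ℂ)) : 0 ≤ (coulombInner T T).re := by
  rw [re_coulombInner_self]
  exact mul_nonneg (inv_nonneg.2 Real.pi_pos.le) (integral_nonneg fun ξ => by positivity)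

/-- The optimal splitting scale between the long-distance and the short-distance part. -/
theorem exists_scale {Λ Z : ℝ} (hΛ : 0 < Λ) (hZ : 0 < Z) : ∃ s : ℝ, 0 < s ∧
    Z ^ 2 / √(2 * s) + s * (Λ ^ 3 / (3 * Real.pi ^ 2) * Z) ≤ c₂ * Λ * Z ^ (5 / 3 : ℝ) := by
  obtain ⟨q, hq, hq3⟩ : ∃ q : ℝ, 0 < q ∧ q ^ 3 = 3 * Real.pi ^ 2 :=
    ⟨(3 * Real.pi ^ 2) ^ (1 / 3 : ℝ), by positivity, by
      rw [← Real.rpow_natCast, ← Real.rpow_mul (by positivity)]; norm_num⟩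
  have hz5 : Z ^ (5 / 3 : ℝ) = (Z ^ (1 / 3 : ℝ)) ^ 5 := by
    rw [← Real.rpow_natCast, ← Real.rpow_mul hZ.le]; norm_num
  have hz3 : (Z ^ (1 / 3 : ℝ)) ^ 3 = Z := by
    rw [← Real.rpow_natCast, ← Real.rpow_mul hZ.le]; norm_num
  set z := Z ^ (1 / 3 : ℝ)
  have hz : 0 < z := by positivity
  -- The optimal scale gives the constant `3 / (2q)`, with cube `9 / (8π²)`, against `c₂³ = 9 /
  -- (16π)`; the inequality reduces to `2 ≤ π`.
  have hc : 3 / (2 * q) ≤ c₂ := by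
    have hc0 : 0 ≤ c₂ := by unfold c₂; positivity
    have hc3 : c₂ ^ 3 = 9 / (16 * Real.pi) := by
      have h1 : ((2 : ℝ) ^ (-(4 / 3) : ℝ)) ^ 3 = 1 / 16 := by
        rw [← Real.rpow_natCast, ← Real.rpow_mul (by norm_num)]
        rw [show (-(4 / 3) : ℝ) * (3 : ℕ) = ((-4 : ℤ) : ℝ) by norm_num, Real.rpow_intCast]
        norm_num
      have h2 : ((3 : ℝ) ^ (2 / 3 : ℝ)) ^ 3 = 9 := by
        rw [← Real.rpow_natCast, ← Real.rpow_mul (by norm_num)]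
        rw [show (2 / 3 : ℝ) * (3 : ℕ) = ((2 : ℤ) : ℝ) by norm_num, Real.rpow_intCast]
        norm_num
      have h3 : (Real.pi ^ (-(1 / 3) : ℝ)) ^ 3 = Real.pi⁻¹ := by
        rw [← Real.rpow_natCast, ← Real.rpow_mul Real.pi_pos.le]
        rw [show (-(1 / 3) : ℝ) * (3 : ℕ) = -1 by norm_num, Real.rpow_neg_one]
      rw [c₂, mul_pow, mul_pow, h1, h2, h3]
      field_simp
    refine le_of_pow_le_pow_left₀ three_ne_zero hc0 ?_
    rw [hc3, div_pow, mul_pow, hq3, div_le_div_iff₀ (by positivity) (by positivity)]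
    nlinarith [Real.pi_gt_three, Real.pi_pos, mul_pos Real.pi_pos Real.pi_pos]
  have hsqrt : √(2 * (q ^ 2 * z ^ 2 / (2 * Λ ^ 2))) = q * z / Λ := by
    rw [show 2 * (q ^ 2 * z ^ 2 / (2 * Λ ^ 2)) = (q * z / Λ) ^ 2 by field_simp]
    exact Real.sqrt_sq (by positivity)
  -- In terms of `u = √(2s)` and `M = Λ³/q³`, the function `Z²/u + u² M Z/2` is minimal at `u³ =
  -- Z/M`, that is `u = q z / Λ`.
  refine ⟨q ^ 2 * z ^ 2 / (2 * Λ ^ 2), by positivity, ?_⟩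
  rw [hsqrt, hz5, ← hq3, ← hz3]
  calc _ = 3 / (2 * q) * Λ * z ^ 5 := by
        field_simp
        ring
    _ ≤ _ := by gcongr

theorem le_energy {α Λ : ℝ} (hα : 0 < α) (hΛ : 0 < Λ) {f : E3 → ℝ}
    (hfC : toDistribution (fun x => (f x : ℂ)) ∈ coulombSpace) (hf : Integrable f)
    (hf0 : 0 < ∫ x, |f x|) {Q : OneParticle Λ →L[ℂ] OneParticle Λ} (hQ : Q ∈ admissible Λ) :
    -(c₂ * α * Λ * (∫ x, |f x|) ^ (5 / 3 : ℝ)) ≤ energy α Λ f Q := by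
  obtain ⟨s, hs, hbound⟩ := exists_scale hΛ hf0
  set Z := ∫ x, |f x| with hZ
  have hkin := re_genTrace_dirac_mul_nonneg hQ
  obtain ⟨ρ, hρ, hM⟩ := exists_representedBy_toDistribution (norm_density_le hΛ.le hQ)
  have hfc : Integrable fun x => (f x : ℂ) := hf.ofReal
  obtain ⟨T₂, hT₂, -⟩ := exists_representedBy_of_integrable hfc
  rw [← hT₂.toDistribution_eq] at hT₂
  set R := toDistribution (density Λ Q)
  set N := toDistribution fun x => (f x : ℂ)
  have hself := re_coulombInner_self_nonneg R
  have hcross : (coulombInner R N).re ≤ 1 / 2 * (coulombInner R R).re +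
      c₂ * Λ * Z ^ (5 / 3 : ℝ) := by
    -- Outside the Coulomb space `coulombHat R` is zero by convention, so the cross term vanishes
    -- and the bound is trivial.
    by_cases hR : R ∈ coulombSpace
    · have h := re_coulombInner_le hR hfC hρ hM hfc hT₂ hs
      have hn : ∫ y, ‖((f y : ℝ) : ℂ)‖ = Z := by simp [hZ]
      rw [hn] at h
      linarith
    · have h : coulombInner R N = 0 := by simp [coulombInner, coulombHat_of_notMem hR]
      rw [h, Complex.zero_re]
      have : 0 ≤ c₂ := by unfold c₂; positivity
      positivity
  have he : energy α Λ f Q = (genTrace Λ (dirac Λ * Q)).re - α * (coulombInner R N).re +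
      α / 2 * (coulombInner R R).re := by
    rw [energy, show (α / 2 : ℂ) = ((α / 2 : ℝ) : ℂ) by push_cast; rfl, Complex.add_re,
      Complex.sub_re, Complex.re_ofReal_mul, Complex.re_ofReal_mul]
  rw [he]
  nlinarith [mul_le_mul_of_nonneg_left hcross hα.le]

end RBDF

end

theorem proposition3p3 (α Λ : ℝ) (hα : 0 < α) (hΛ : 0 < Λ) (ν : RBDF.E3 → ℝ)
    (hνC : RBDF.toDistribution (fun x => (ν x : ℂ)) ∈ RBDF.coulombSpace)
    (hνint : Integrable ν volume) (hν1 : ∫ x, |ν x| = 1) (Z : ℝ) (hZ : 0 < Z) :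
    ((-(RBDF.c₂ * α * Λ * Z ^ (5 / 3 : ℝ)) : ℝ) : EReal) ≤
      RBDF.groundStateEnergy α Λ ν Z := by
  have hnorm : ∫ x, |Z * ν x| = Z := by
    simp_rw [abs_mul, abs_of_pos hZ]
    rw [integral_const_mul, hν1, mul_one]
  -- Since `ν` is integrable, `toDistribution` is not its default value here; uniqueness makes it
  -- compatible with scaling by `Z`.
  have hmem : RBDF.toDistribution (fun x => ((Z * ν x : ℝ) : ℂ)) ∈ RBDF.coulombSpace := by
    obtain ⟨T, hT, -⟩ := RBDF.exists_representedBy_of_integrable hνint.ofReal (f := fun x => (ν x : ℂ))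
    have hZT : RBDF.RepresentedBy ((Z : ℂ) • T) fun x => ((Z * ν x : ℝ) : ℂ) := by
      simpa only [Complex.ofReal_mul] using hT.const_smul (Z : ℂ)
    rw [hZT.toDistribution_eq]
    rw [hT.toDistribution_eq] at hνC
    exact RBDF.smul_mem_coulombSpace hνC _
  rw [RBDF.groundStateEnergy]
  refine le_iInf₂ fun Q hQ => EReal.coe_le_coe_iff.2 ?_
  have h := RBDF.le_energy hα hΛ hmem (hνint.const_mul Z) (hnorm.symm ▸ hZ) hQ
  rwa [hnorm] at h
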